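/- Let $T>0$, $H\in(\tfrac12,1)$ and $a,b\in\mathbb R$ with $ab\neq 0$. Write $L^2=L^2([0,T])$, $\mathbf 1_t=\mathbf 1_{[0,t)}$, $$c(H)=\sqrt{\frac{2H\,\Gamma(\frac32-H)}{\Gamma(H+\frac12)\Gamma(2-2H)}}\,\Bigl(H-\tfrac12\Bigr),\qquad K_H(t,s)=\frac{c(H)}{s^{H-\frac12}}\int_s^t\frac{u^{H-\frac12}}{(u-s)^{\frac32-H}}\,du\quad(s<t),$$ and $K_H(t,s)=0$ for $s\ge t$. For a square-integrable process $Y=(Y_t)_{t\in[0,T]}$ with $R_Y(t,s)=\mathbb E[Y_tY_s]$, let $\Lambda_Y$ be the completion of the linear span of the indicators $\mathbf 1_t$, $t\in[0,T]$, under the inner product generated by $\langle\mathbf 1_t,\mathbf 1_s\rangle=R_Y(t,s)$; the abstract Wiener integral $f\mapsto\int_0^Tf\,dY$ is the isometry from $\Lambda_Y$ into $L^2(\Omega)$ that extends $\mathbf 1_t\mapsto Y_t$. We say $\Lambda_Y=L^2$ if $\mathbf 1_t\mapsto\mathbf 1_t$ extends to an isomorphism of topological vector spaces $\Lambda_Y\to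 L^2$; then $\int_0^Tf\,dY$ is defined for every $f\in L^2$. Let $W$ be a standard Brownian motion on $[0,T]$ and let $X$ be the completely correlated mixed fractional Brownian motion $X_t=aW_t+b\int_0^TK_H(t,s)\,dW_s$ (a.s. for each $t\in[0,T]$). Put $L(t,s)=a\mathbf 1_t(s)+bK_H(t,s)$ and $$L^{-1}(t,s)=\frac1a\mathbf 1_t(s)+\frac1a\sum_{k=1}^\infty(-1)^k\Bigl(\frac ba\Bigr)^k\gamma_k(t,s),$$ $$\gamma_k(t,s)=\frac{c(H)^k\,\Gamma(H-\frac12)^k}{\Gamma(k(H-\frac12))}\,\frac1{s^{H-\frac12}}\int_s^tu^{H-\frac12}(u-s)^{k(H-\frac12)-1}\,du\quad(s<t),\qquad\gamma_k(t,s)=0\quad(s\ge t).$$ Then $\Lambda_W=L^2$ and $\Lambda_X=L^2$; for all $t\in[0,T]$ and $0<s\le T$ the series for $L^{-1}(t,s)$ converges absolutely, and $t\mapsto L^{-1}(t,s)$ is of bounded variation on $[0,T]$. There is a bounded linear operator $\mathrm L^*$ on $L^2$ with bounded inverse such that $\mathrm L^*\mathbf 1_t=L(t,\cdot)$ and $(\mathrm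 L^*)^{-1}\mathbf 1_t=L^{-1}(t,\cdot)$ for all $t\in[0,T]$, and for every $f\in L^2$, for almost every $t\in[0,T]$, $$\mathrm L^*f(t)=af(t)+b\int_t^Tf(s)\,\frac{\partial K_H}{\partial s}(s,t)\,ds,$$ $$(\mathrm L^*)^{-1}f(t)=f(t)L^{-1}(T,t)+\int_t^T[f(s)-f(t)]\,L^{-1}(ds,t),$$ where both integrals converge absolutely for almost every $t$, the second being the Lebesgue--Stieltjes integral with respect to $s\mapsto L^{-1}(s,t)$. Moreover, for every $f\in L^2$, almost surely, $$\int_0^Tf(t)\,dX_t=\int_0^T\mathrm L^*f(t)\,dW_t,\qquad\int_0^Tf(t)\,dW_t=\int_0^T(\mathrm L^*)^{-1}f(t)\,dX_t.$$ -/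

import Mathlib

open MeasureTheory ProbabilityTheory Set
open scoped ENNReal

noncomputable section

namespace CCMFBm

/-! ### Square-integrable processes on `[0, T]`, integrand space and abstract Wiener integral -/

/-- Lebesgue measure on `[0, T]`. -/
abbrev leb (T : ℝ) : Measure ℝ := volume.restrict (Icc 0 T)

/-- The real Hilbert space `L²[0, T]`. -/
abbrev L2 (T : ℝ) : Type := Lp ℝ 2 (leb T)

/-- The indicator function `1_t = 1_{[0,t)}`. -/
def ind (t s : ℝ) : ℝ := (Ico 0 t).indicator (fun _ => (1 : ℝ)) s

/-- The class of `1_t` in `L²[0, T]`. -/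
def indL2 (T t : ℝ) : L2 T :=
  indicatorConstLp 2 (measurableSet_Ico (a := (0 : ℝ)) (b := t))
    (((Measure.restrict_apply_le _ _).trans_lt measure_Ico_lt_top).ne) (1 : ℝ)

variable {Ω : Type*} [MeasurableSpace Ω]

/-- A real stochastic process indexed by `[0, T]` with square-integrable marginals. -/
structure SquareIntegrableProcess (P : Measure Ω) (T : ℝ) where
  toFun : Icc (0 : ℝ) T → Ω → ℝ
  memLp : ∀ t, MemLp (toFun t) 2 P

variable {P : Measure Ω} {T : ℝ}

instance : CoeFun (SquareIntegrableProcess P T) (fun _ => Icc (0 : ℝ) T → Ω → ℝ) where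
  coe Y := Y.toFun

/-- The class of `Y_t` in `L²(Ω)`. -/
def SquareIntegrableProcess.toL2 (Y : SquareIntegrableProcess P T) (t : Icc (0 : ℝ) T) :
    Lp ℝ 2 P :=
  (Y.memLp t).toLp (Y t)

/-- The function `R(t,s) = E[Y_t Y_s]`, which is the covariance function when `Y` is centered. -/
def covFun (Y : SquareIntegrableProcess P T) (t s : Icc (0 : ℝ) T) : ℝ :=
  ∫ ω, Y t ω * Y s ω ∂P

/-- Formal linear combinations `∑ c_t 1_t` of the indicator functions `1_t`, `t ∈ [0, T]`.
The process `Y` is a parameter because the inner product depends on it. -/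
def StepFn (_Y : SquareIntegrableProcess P T) : Type := Icc (0 : ℝ) T →₀ ℝ

instance (Y : SquareIntegrableProcess P T) : AddCommGroup (StepFn Y) :=
  inferInstanceAs (AddCommGroup (Icc (0 : ℝ) T →₀ ℝ))

instance (Y : SquareIntegrableProcess P T) : Module ℝ (StepFn Y) :=
  inferInstanceAs (Module ℝ (Icc (0 : ℝ) T →₀ ℝ))

/-- `1_t` as a formal linear combination. -/
def stepInd (Y : SquareIntegrableProcess P T) (t : Icc (0 : ℝ) T) : StepFn Y :=
  Finsupp.single t (1 : ℝ)

/-- The linear map `∑ c_t 1_t ↦ ∑ c_t Y_t`. -/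
def stepMap (Y : SquareIntegrableProcess P T) : StepFn Y →ₗ[ℝ] Lp ℝ 2 P :=
  Finsupp.linearCombination ℝ Y.toL2

/-- The bilinear form generated by `⟨1_t, 1_s⟩ = R(t,s)`. -/
def stepInner (Y : SquareIntegrableProcess P T) (c d : StepFn Y) : ℝ :=
  Finsupp.sum c fun t x => Finsupp.sum d fun s y => x * y * covFun Y t s

theorem inner_toL2 (Y : SquareIntegrableProcess P T) (t s : Icc (0 : ℝ) T) :
    inner ℝ (Y.toL2 t) (Y.toL2 s) = covFun Y t s := by
  rw [L2.inner_def]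
  refine integral_congr_ae ?_
  filter_upwards [(Y.memLp t).coeFn_toLp, (Y.memLp s).coeFn_toLp] with ω h1 h2
  simp only [SquareIntegrableProcess.toL2, h1, h2]
  simp [mul_comm]

theorem stepInner_eq (Y : SquareIntegrableProcess P T) (c d : StepFn Y) :
    stepInner Y c d = inner ℝ (stepMap Y c) (stepMap Y d) := by
  have h : ∀ e : StepFn Y, stepMap Y e = Finsupp.sum e fun t x => x • Y.toL2 t :=
    fun e => Finsupp.linearCombination_apply ℝ e
  simp only [stepInner, h, Finsupp.sum, sum_inner, inner_sum, inner_smul_left, inner_smul_right,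
    inner_toL2, Finset.mul_sum, RCLike.conj_to_real]
  rw [Finset.sum_comm]
  exact Finset.sum_congr rfl fun _ _ => Finset.sum_congr rfl fun _ _ => by ring

/-- The (semi-definite) inner product on step functions. -/
@[reducible]
def stepCore (Y : SquareIntegrableProcess P T) : PreInnerProductSpace.Core ℝ (StepFn Y) where
  inner := stepInner Y
  conj_inner_symm c d := by
    simp only [stepInner_eq]
    exact inner_conj_symm _ _
  re_inner_nonneg c := by
    simp only [stepInner_eq]
    exact inner_self_nonneg
  add_left c d e := by
    simp only [stepInner_eq, map_add, inner_add_left]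
  smul_left c d r := by
    simp only [stepInner_eq, map_smul, inner_smul_left]

instance (Y : SquareIntegrableProcess P T) : SeminormedAddCommGroup (StepFn Y) :=
  @InnerProductSpace.Core.toSeminormedAddCommGroup ℝ (StepFn Y) _ _ _ (stepCore Y)

instance (Y : SquareIntegrableProcess P T) : InnerProductSpace ℝ (StepFn Y) :=
  InnerProductSpace.ofCore (stepCore Y)

/-- The integrand space `Λ` of `Y`: the closure (completion) of the span of the indicator
functions `1_t` under the inner product generated by `⟨1_t, 1_s⟩ = R(t,s)`. -/
abbrev Lam (Y : SquareIntegrableProcess P T) : Type := UniformSpace.Completion (StepFn Y)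

/-- `1_t` as an element of `Λ`. -/
def indLam (Y : SquareIntegrableProcess P T) (t : Icc (0 : ℝ) T) : Lam Y :=
  (stepInd Y t : Lam Y)

/-- The isometry `∑ c_t 1_t ↦ ∑ c_t Y_t` on step functions. -/
def stepIsometry (Y : SquareIntegrableProcess P T) : StepFn Y →ₗᵢ[ℝ] Lp ℝ 2 P where
  toLinearMap := stepMap Y
  norm_map' c := by
    have h : inner ℝ c c = inner ℝ (stepMap Y c) (stepMap Y c) := stepInner_eq Y c c
    rw [real_inner_self_eq_norm_sq, real_inner_self_eq_norm_sq] at h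
    exact ((sq_eq_sq₀ (norm_nonneg _) (norm_nonneg _)).1 h).symm

/-- The isometry from `Λ` into `L²(Ω)` that extends `1_t ↦ Y_t` (its range is the first
chaos of `Y`). -/
def chaosMap (Y : SquareIntegrableProcess P T) : Lam Y → Lp ℝ 2 P :=
  UniformSpace.Completion.extension (stepIsometry Y)

theorem chaosMap_indLam (Y : SquareIntegrableProcess P T) (t : Icc (0 : ℝ) T) :
    chaosMap Y (indLam Y t) = Y.toL2 t := by
  rw [chaosMap, indLam,
    UniformSpace.Completion.extension_coe (stepIsometry Y).isometry.uniformContinuous]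
  change Finsupp.linearCombination ℝ Y.toL2 (Finsupp.single t 1) = _
  simp

/-- `Λ = L²[0, T]`: the correspondence `1_t ↔ 1_t` extends to an isomorphism of
topological vector spaces between `Λ` and `L²[0, T]` (this isomorphism is unique, the span of
the indicators being dense in `Λ`). -/
def IntegrandSpaceEqL2 (Y : SquareIntegrableProcess P T) : Prop :=
  ∃ e : Lam Y ≃L[ℝ] L2 T, ∀ t : Icc (0 : ℝ) T, e (indLam Y t) = indL2 T t

open Classical in
/-- The abstract Wiener integral `∫_0^T f dY ∈ L²(Ω)` of `f ∈ L²[0, T]` with respect to a process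
`Y` whose integrand space is `L²[0, T]`: the image of `f`, read as an element of `Λ`, under the
isometry that extends `1_t ↦ Y_t`. (Default value `0` if `f ∉ L²[0, T]` or `Λ ≠ L²[0, T]`.) -/
def wienerIntegral (Y : SquareIntegrableProcess P T) (f : ℝ → ℝ) : Lp ℝ 2 P :=
  if h : IntegrandSpaceEqL2 Y ∧ MemLp f 2 (leb T) then
    chaosMap Y (h.1.choose.symm (h.2.toLp f))
  else 0

/-! ### Brownian motion and the completely correlated mixed fractional Brownian motion -/

/-- `W` is a standard Brownian motion on `[0, T]`. -/
structure IsBrownianMotion (W : SquareIntegrableProcess P T) : Prop where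
  gaussian : IsGaussianProcess W.toFun P
  mean : ∀ t, ∫ ω, W t ω ∂P = 0
  cov : ∀ t s, cov[W t, W s; P] = min (t : ℝ) (s : ℝ)
  cont : ∀ᵐ ω ∂P, Continuous fun t => W t ω

/-- The constant `c(H)`. -/
def cH (H : ℝ) : ℝ :=
  Real.sqrt (2 * H * Real.Gamma (3 / 2 - H) / (Real.Gamma (H + 1 / 2) * Real.Gamma (2 - 2 * H)))
    * (H - 1 / 2)

/-- The Molchan--Golosov kernel `K_H(t,s)`, zero unless `s < t`. -/
def KH (H t s : ℝ) : ℝ :=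
  if s < t then
    cH H * (1 / s ^ (H - 1 / 2)) * ∫ u in s..t, u ^ (H - 1 / 2) / (u - s) ^ (3 / 2 - H)
  else 0

/-- `X = a W + b B^H` with `B^H_t = ∫_0^t K_H(t,s) dW_s`, almost surely for each `t`. -/
def IsCCMFBm (a b H : ℝ) (W X : SquareIntegrableProcess P T) : Prop :=
  ∀ t : Icc (0 : ℝ) T,
    X t =ᵐ[P] fun ω => a * W t ω + b * wienerIntegral W (fun s => KH H t s) ω

/-! ### The kernels and operators of the transfer principle -/

/-- The kernel `L(t,s) = a 1_t(s) + b K_H(t,s)`. -/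
def Lker (a b H t s : ℝ) : ℝ := a * ind t s + b * KH H t s

/-- The kernel `γ_k(t,s)`, zero unless `s < t`. -/
def gam (H : ℝ) (k : ℕ) (t s : ℝ) : ℝ :=
  if s < t then
    cH H ^ k * Real.Gamma (H - 1 / 2) ^ k / Real.Gamma (k * (H - 1 / 2)) * (1 / s ^ (H - 1 / 2))
      * ∫ u in s..t, u ^ (H - 1 / 2) * (u - s) ^ (k * (H - 1 / 2) - 1)
  else 0

/-- The `k`-th term of the series in the inverse kernel. -/
def LinvTerm (a b H t s : ℝ) (k : ℕ) : ℝ := (-1) ^ k * (b / a) ^ k * gam H k t s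

/-- The kernel `L⁻¹(t,s) = (1/a) 1_t(s) + (1/a) ∑_{k ≥ 1} (-1)^k (b/a)^k γ_k(t,s)`. -/
def Linv (a b H t s : ℝ) : ℝ :=
  1 / a * ind t s + 1 / a * ∑' k : ℕ, LinvTerm a b H t s (k + 1)

/-- `L^* f(t) = a f(t) + b ∫_t^T f(s) ∂_s K_H(s,t) ds`. -/
def Lstar (a b H T : ℝ) (f : ℝ → ℝ) (t : ℝ) : ℝ :=
  a * f t + b * ∫ s in t..T, f s * deriv (fun u => KH H u t) s

open Classical in
/-- The Lebesgue--Stieltjes signed measure `dg` on `[t, T]` of a function `g` of bounded variation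
on `[t, T]`; here `g` is extended to the real line by `g(t)` on the left of `t` and by `g(T)` on the
right of `T`. (Default value `0` if `g` is not of bounded variation.) -/
def stieltjes (g : ℝ → ℝ) (t T : ℝ) : SignedMeasure ℝ :=
  if h : BoundedVariationOn (fun s => g (max t (min s T))) univ then h.vectorMeasure else 0

/-- `(L^*)⁻¹ f(t) = f(t) L⁻¹(T,t) + ∫_t^T [f(s) - f(t)] L⁻¹(ds,t)`. -/
def LstarInv (a b H T : ℝ) (f : ℝ → ℝ) (t : ℝ) : ℝ :=
  f t * Linv a b H T t
    + (((stieltjes (fun s => Linv a b H s t) t T).restrict (Icc t T)).integral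
        (fun s => f s - f t) (ContinuousLinearMap.lsmul ℝ ℝ))

end CCMFBm

end

/-! Put α = H − 1/2, which lies in (0, 1/2), and z = −(b/a) c(H) Γ(α). Differentiating K_H gives b
∂_s K_H(s,t) = −a t^{−α} s^α e(s − t) with e(x) = z x^{α−1}/Γ(α). Hence the operator is a(I − E),
where E has the weighted Volterra kernel t^{−α} s^α e(s − t) on t < s ≤ T. When two such kernels are
composed, the intermediate weights u^α u^{−α} cancel, so the profiles are simply convolved
(`integral_volterraKer_mul_volterraKer`). By the Beta integral the k-th convolution power of e is
z^k x^{kα−1}/Γ(kα). The growth of Γ makes the sum ρ of these powers converge, and e ∗ ρ = ρ − e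
(`vconv_mlTerm_one_mlKer`). With R the operator of profile ρ, the inverse is therefore (1/a)(I + R)
(`exists_volterraEquiv`). Both profiles are O(x^{α−1}) on (0, T], and Schur's test with weight
s^{−α} bounds both operators on L²; this is where H < 1 enters.

Applying the inverse to 1_t gives the kernel L⁻¹(t,s): as a function of t it has a jump 1/a at s and
an absolutely continuous part whose density is the kernel of R divided by a. Its Stieltjes measure
is thus explicit, and the second integral formula becomes (1/a)(f + Rf) (`stieltjes_Linv`).

On the probabilistic side, the covariance of W is the L² inner product of indicators, so the Wiener
integral of W is an isometry on L². Since X_t is the W-integral of the image of 1_t, the covariance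
of X is the pull-back of that inner product by an isomorphism, which identifies its integrand space
with L² (`integrandSpaceEqL2_of_covFun`). The transfer identities compare bounded operators that
agree on the indicators, a total set. -/

noncomputable section

namespace CCMFBm

open scoped NNReal

/-! ### Integral operators on `L²` with absolutely bounded kernels -/

/-- A jointly measurable kernel whose absolute value is bounded on `L²(μ)`. -/
structure IsL2Kernel (μ : Measure ℝ) (K : ℝ → ℝ → ℝ) : Prop where
  measurable : Measurable (Function.uncurry K)
  bound : ∃ C : ℝ≥0, ∀ g : ℝ → ℝ≥0∞, Measurable g →
    ∫⁻ t, (∫⁻ s, ‖K t s‖ₑ * g s ∂μ) ^ 2 ∂μ ≤ C * ∫⁻ s, g s ^ 2 ∂μ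

/-- The Cauchy--Schwarz inequality with respect to a weight `w`. -/
theorem sq_lintegral_mul_le_weight {μ : Measure ℝ} {k w g : ℝ → ℝ≥0∞} (hk : Measurable k)
    (hw : Measurable w) (hg : Measurable g) (h0 : ∀ᵐ s ∂μ, w s ≠ 0 ∧ w s ≠ ∞) :
    (∫⁻ s, k s * g s ∂μ) ^ 2 ≤ (∫⁻ s, k s * w s ∂μ) * ∫⁻ s, k s * (w s)⁻¹ * g s ^ 2 ∂μ := by
  -- Factor k g = (k w)^{1/2} (k w⁻¹ g²)^{1/2}.
  have hcs := ENNReal.lintegral_mul_le_Lp_mul_Lq μ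
    (Real.HolderConjugate.two_two)
    (f := fun s => (k s * w s) ^ (1 / 2 : ℝ)) (g := fun s => (k s * (w s)⁻¹ * g s ^ 2) ^ (1 / 2 : ℝ))
    (by fun_prop) (by fun_prop)
  have e1 : ∀ x : ℝ≥0∞, (x ^ (1 / 2 : ℝ)) ^ (2 : ℝ) = x := fun x => by
    rw [← ENNReal.rpow_mul]; norm_num
  have e2 : ∀ x : ℝ≥0∞, (x ^ (1 / 2 : ℝ)) ^ 2 = x := fun x => by
    rw [← ENNReal.rpow_natCast, ← ENNReal.rpow_mul]; norm_num
  have e3 : ∀ x : ℝ≥0∞, (x ^ 2) ^ (1 / 2 : ℝ) = x := fun x => by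
    rw [← ENNReal.rpow_natCast, ← ENNReal.rpow_mul]; norm_num
  have hl : ∫⁻ s, k s * g s ∂μ = ∫⁻ s, ((fun s => (k s * w s) ^ (1 / 2 : ℝ)) *
      fun s => (k s * (w s)⁻¹ * g s ^ 2) ^ (1 / 2 : ℝ)) s ∂μ := by
    refine lintegral_congr_ae ?_
    filter_upwards [h0] with s hs
    simp only [Pi.mul_apply]
    rw [← ENNReal.mul_rpow_of_nonneg _ _ (by norm_num : (0 : ℝ) ≤ 1 / 2)]
    have : k s * w s * (k s * (w s)⁻¹ * g s ^ 2) = (k s * g s) ^ 2 := by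
      calc k s * w s * (k s * (w s)⁻¹ * g s ^ 2) = (w s * (w s)⁻¹) * (k s * g s) ^ 2 := by ring
        _ = _ := by rw [ENNReal.mul_inv_cancel hs.1 hs.2, one_mul]
    rw [this, e3]
  rw [hl]
  simp only [e1] at hcs
  calc _ ≤ (_ : ℝ≥0∞) ^ 2 := pow_le_pow_left₀ zero_le hcs 2
    _ = _ := by rw [mul_pow, e2, e2]

/-- Schur's test. -/
theorem isL2Kernel_of_schur {μ : Measure ℝ} [SFinite μ] {K : ℝ → ℝ → ℝ}
    (hK : Measurable (Function.uncurry K)) {w : ℝ → ℝ≥0∞} (hw : Measurable w)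
    (h0 : ∀ᵐ s ∂μ, w s ≠ 0 ∧ w s ≠ ∞) (C₁ C₂ : ℝ≥0)
    (h1 : ∀ᵐ t ∂μ, ∫⁻ s, ‖K t s‖ₑ * w s ∂μ ≤ C₁ * w t)
    (h2 : ∀ᵐ s ∂μ, ∫⁻ t, ‖K t s‖ₑ * w t ∂μ ≤ C₂ * w s) : IsL2Kernel μ K := by
  refine ⟨hK, C₁ * C₂, fun g hg => ?_⟩
  have hKe : Measurable fun p : ℝ × ℝ => ‖K p.1 p.2‖ₑ := hK.enorm
  have hK1 : ∀ t, Measurable fun s => ‖K t s‖ₑ := fun t => hKe.comp measurable_prodMk_left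
  have hK2 : ∀ s, Measurable fun t => ‖K t s‖ₑ := fun s => hKe.comp measurable_prodMk_right
  calc ∫⁻ t, (∫⁻ s, ‖K t s‖ₑ * g s ∂μ) ^ 2 ∂μ
      ≤ ∫⁻ t, C₁ * w t * ∫⁻ s, ‖K t s‖ₑ * (w s)⁻¹ * g s ^ 2 ∂μ ∂μ := by
        refine lintegral_mono_ae ?_
        filter_upwards [h1] with t ht
        exact (sq_lintegral_mul_le_weight (hK1 t) hw hg h0).trans (by gcongr)
    _ = ∫⁻ t, ∫⁻ s, C₁ * w t * (‖K t s‖ₑ * (w s)⁻¹ * g s ^ 2) ∂μ ∂μ := by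
        refine lintegral_congr fun t => ?_
        rw [lintegral_const_mul]
        have := hK1 t
        fun_prop
    _ = ∫⁻ s, ∫⁻ t, C₁ * w t * (‖K t s‖ₑ * (w s)⁻¹ * g s ^ 2) ∂μ ∂μ := by
        refine lintegral_lintegral_swap (Measurable.aemeasurable ?_)
        change Measurable fun p : ℝ × ℝ => C₁ * w p.1 * (‖K p.1 p.2‖ₑ * (w p.2)⁻¹ * g p.2 ^ 2)
        fun_prop
    -- After Tonelli the inner integral is at most C₂ w(s), which cancels w(s)⁻¹.
    _ ≤ ∫⁻ s, C₁ * C₂ * g s ^ 2 ∂μ := by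
        refine lintegral_mono_ae ?_
        filter_upwards [h2, h0] with s hs hs0
        have := hK2 s
        calc ∫⁻ t, C₁ * w t * (‖K t s‖ₑ * (w s)⁻¹ * g s ^ 2) ∂μ
            = ∫⁻ t, C₁ * (w s)⁻¹ * g s ^ 2 * (‖K t s‖ₑ * w t) ∂μ :=
              lintegral_congr fun t => by ring
          _ = C₁ * (w s)⁻¹ * g s ^ 2 * ∫⁻ t, ‖K t s‖ₑ * w t ∂μ :=
              lintegral_const_mul _ (by fun_prop)
          _ ≤ C₁ * (w s)⁻¹ * g s ^ 2 * (C₂ * w s) := by gcongr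
          _ = C₁ * C₂ * g s ^ 2 * (w s * (w s)⁻¹) := by ring
          _ = _ := by rw [ENNReal.mul_inv_cancel hs0.1 hs0.2, mul_one]
    _ = _ := by
        rw [lintegral_const_mul _ (by fun_prop)]
        simp

/-! ### Operators defined by absolutely bounded kernels, and their composition -/

namespace IsL2Kernel

variable {μ : Measure ℝ} {K K' : ℝ → ℝ → ℝ} {f g : ℝ → ℝ}

theorem const_mul (hK : IsL2Kernel μ K) (c : ℝ) : IsL2Kernel μ fun t s => c * K t s := by
  obtain ⟨hm, C, hC⟩ := hK
  refine ⟨hm.const_mul c, ‖c‖₊ ^ 2 * C, fun g hg => ?_⟩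
  have h : ∀ t, (∫⁻ s, ‖c * K t s‖ₑ * g s ∂μ) ^ 2 = ‖c‖ₑ ^ 2 * (∫⁻ s, ‖K t s‖ₑ * g s ∂μ) ^ 2 := by
    intro t
    have hm1 : Measurable fun s => ‖K t s‖ₑ := hm.enorm.comp measurable_prodMk_left
    simp only [enorm_mul, mul_assoc]
    rw [lintegral_const_mul _ (by fun_prop), mul_pow]
  simp only [h]
  rw [lintegral_const_mul' _ _ (by finiteness)]
  calc _ ≤ ‖c‖ₑ ^ 2 * (C * ∫⁻ s, g s ^ 2 ∂μ) := by gcongr; exact hC g hg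
    _ = _ := by simp [mul_assoc, enorm_eq_nnnorm]

theorem of_le (hK : IsL2Kernel μ K) (hm : Measurable (Function.uncurry K'))
    (h : ∀ t s, |K' t s| ≤ K t s) : IsL2Kernel μ K' := by
  obtain ⟨_, C, hC⟩ := hK
  refine ⟨hm, C, fun g hg => le_trans ?_ (hC g hg)⟩
  gcongr with t s
  rw [← ofReal_norm, ← ofReal_norm]
  exact ENNReal.ofReal_le_ofReal ((h t s).trans (le_abs_self _))

theorem measurable_left (hK : IsL2Kernel μ K) (t : ℝ) : Measurable (K t) :=
  hK.measurable.comp measurable_prodMk_left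

theorem exists_lintegral_le (hK : IsL2Kernel μ K) : ∃ C : ℝ≥0, ∀ f : ℝ → ℝ,
    AEStronglyMeasurable f μ →
    ∫⁻ t, (∫⁻ s, ‖K t s * f s‖ₑ ∂μ) ^ 2 ∂μ ≤ C * ∫⁻ s, ‖f s‖ₑ ^ 2 ∂μ := by
  obtain ⟨C, hC⟩ := hK.bound
  refine ⟨C, fun f hf => ?_⟩
  have h1 : ∀ t, ∫⁻ s, ‖K t s * f s‖ₑ ∂μ = ∫⁻ s, ‖K t s‖ₑ * ‖hf.mk f s‖ₑ ∂μ := fun t => by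
    refine lintegral_congr_ae ?_
    filter_upwards [hf.ae_eq_mk] with s hs
    rw [enorm_mul, hs]
  have h2 : ∫⁻ s, ‖f s‖ₑ ^ 2 ∂μ = ∫⁻ s, ‖hf.mk f s‖ₑ ^ 2 ∂μ := by
    refine lintegral_congr_ae ?_
    filter_upwards [hf.ae_eq_mk] with s hs
    rw [hs]
  simp only [h1]
  rw [h2]
  exact hC _ hf.stronglyMeasurable_mk.measurable.enorm

theorem lintegral_sq_lt_top (hf : MemLp f 2 μ) : ∫⁻ s, ‖f s‖ₑ ^ 2 ∂μ < ∞ := by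
  have := (eLpNorm_lt_top_iff_lintegral_rpow_enorm_lt_top (by norm_num) (by norm_num)).1 hf.2
  simpa using this

theorem aestronglyMeasurable_mul [SFinite μ] (hK : IsL2Kernel μ K)
    (hf : AEStronglyMeasurable f μ) :
    AEStronglyMeasurable (fun p : ℝ × ℝ => K p.1 p.2 * f p.2) (μ.prod μ) :=
  hK.measurable.aestronglyMeasurable.mul hf.comp_snd

/-- The bound controls the L² norm of ∫ |K f|, which must then be finite almost everywhere. -/
theorem ae_integrable [SFinite μ] (hK : IsL2Kernel μ K) (hf : MemLp f 2 μ) :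
    ∀ᵐ t ∂μ, Integrable (fun s => K t s * f s) μ := by
  obtain ⟨C, hC⟩ := hK.exists_lintegral_le
  have hlt : ∫⁻ t, (∫⁻ s, ‖K t s * f s‖ₑ ∂μ) ^ 2 ∂μ < ∞ :=
    (hC f hf.1).trans_lt (ENNReal.mul_lt_top ENNReal.coe_lt_top (lintegral_sq_lt_top hf))
  have hme : AEMeasurable (fun t => ∫⁻ s, ‖K t s * f s‖ₑ ∂μ) μ :=
    (hK.aestronglyMeasurable_mul hf.1).enorm.lintegral_prod_right'
  filter_upwards [ae_lt_top' (hme.pow_const 2) hlt.ne] with t ht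
  refine ⟨(hK.measurable_left t).aestronglyMeasurable.mul hf.1, ?_⟩
  rw [HasFiniteIntegral]
  by_contra h
  rw [not_lt_top_iff] at h
  simp only [h] at ht
  simp at ht

theorem exists_eLpNorm_le [SFinite μ] (hK : IsL2Kernel μ K) : ∃ C : ℝ≥0, ∀ f : ℝ → ℝ,
    AEStronglyMeasurable f μ →
      eLpNorm (fun t => ∫ s, K t s * f s ∂μ) 2 μ ≤ C * eLpNorm f 2 μ := by
  obtain ⟨C, hC⟩ := hK.exists_lintegral_le
  refine ⟨NNReal.sqrt C, fun f hf => ?_⟩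
  rw [eLpNorm_eq_lintegral_rpow_enorm_toReal (by norm_num) (by norm_num),
    eLpNorm_eq_lintegral_rpow_enorm_toReal (by norm_num) (by norm_num)]
  simp only [ENNReal.toReal_ofNat, ENNReal.rpow_ofNat]
  have hs : ((NNReal.sqrt C : ℝ≥0) : ℝ≥0∞) = (C : ℝ≥0∞) ^ (1 / 2 : ℝ) := by
    rw [NNReal.sqrt_eq_rpow, ENNReal.coe_rpow_of_nonneg _ (by norm_num)]
  rw [hs, ← ENNReal.mul_rpow_of_nonneg _ _ (by norm_num : (0 : ℝ) ≤ 1 / 2)]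
  refine ENNReal.rpow_le_rpow (le_trans ?_ (hC f hf)) (by norm_num)
  gcongr
  exact enorm_integral_le_lintegral_enorm _

theorem memLp_integral [SFinite μ] (hK : IsL2Kernel μ K) (hf : MemLp f 2 μ) :
    MemLp (fun t => ∫ s, K t s * f s ∂μ) 2 μ := by
  obtain ⟨C, hC⟩ := hK.exists_eLpNorm_le
  exact ⟨(hK.aestronglyMeasurable_mul hf.1).integral_prod_right',
    (hC f hf.1).trans_lt (ENNReal.mul_lt_top ENNReal.coe_lt_top hf.2)⟩

/-- The integral operator on `L²` with kernel `K`. -/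
def op [SFinite μ] (hK : IsL2Kernel μ K) : Lp ℝ 2 μ →L[ℝ] Lp ℝ 2 μ :=
  LinearMap.mkContinuousOfExistsBound
    { toFun := fun f => (hK.memLp_integral (Lp.memLp f)).toLp _
      map_add' := fun f g => by
        rw [← MemLp.toLp_add]
        refine (MemLp.toLp_eq_toLp_iff _ _).2 ?_
        filter_upwards [hK.ae_integrable (Lp.memLp f), hK.ae_integrable (Lp.memLp g)] with t h1 h2
        rw [Pi.add_apply, ← integral_add h1 h2]
        refine integral_congr_ae ?_
        filter_upwards [Lp.coeFn_add f g] with s hs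
        rw [hs, Pi.add_apply, mul_add]
      map_smul' := fun c f => by
        rw [RingHom.id_apply, ← MemLp.toLp_const_smul]
        refine (MemLp.toLp_eq_toLp_iff _ _).2 (Filter.Eventually.of_forall fun t => ?_)
        rw [Pi.smul_apply, smul_eq_mul, ← integral_const_mul]
        refine integral_congr_ae ?_
        filter_upwards [Lp.coeFn_smul c f] with s hs
        rw [hs, Pi.smul_apply, smul_eq_mul, mul_left_comm] }
    (by
      obtain ⟨C, hC⟩ := hK.exists_eLpNorm_le
      refine ⟨C, fun f => ?_⟩
      simp only [LinearMap.coe_mk, AddHom.coe_mk, Lp.norm_toLp]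
      rw [Lp.norm_def, ← ENNReal.coe_toReal, ← ENNReal.toReal_mul]
      exact ENNReal.toReal_mono (ENNReal.mul_ne_top ENNReal.coe_ne_top (Lp.eLpNorm_ne_top f))
        (hC f (Lp.aestronglyMeasurable f)))

theorem op_ae_eq [SFinite μ] (hK : IsL2Kernel μ K) (f : Lp ℝ 2 μ) :
    hK.op f =ᵐ[μ] fun t => ∫ s, K t s * f s ∂μ :=
  (hK.memLp_integral (Lp.memLp f)).coeFn_toLp

theorem op_toLp_ae_eq [SFinite μ] (hK : IsL2Kernel μ K) (hf : MemLp f 2 μ) :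
    hK.op (hf.toLp f) =ᵐ[μ] fun t => ∫ s, K t s * f s ∂μ := by
  refine (hK.op_ae_eq _).trans (Filter.Eventually.of_forall fun t => integral_congr_ae ?_)
  filter_upwards [hf.coeFn_toLp] with s hs
  rw [hs]

theorem abs (hK : IsL2Kernel μ K) : IsL2Kernel μ fun t s => |K t s| := by
  obtain ⟨C, hC⟩ := hK.bound
  refine ⟨hK.measurable.norm, C, fun g hg => ?_⟩
  simpa [Real.enorm_abs] using hC g hg

/-- Fubini applies for almost every t because |K'| maps |f| into L², on which K converges
absolutely. -/
theorem op_comp_ae_eq [SFinite μ] (hK : IsL2Kernel μ K) (hK' : IsL2Kernel μ K')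
    (f : Lp ℝ 2 μ) :
    hK.op (hK'.op f) =ᵐ[μ] fun t => ∫ s, (∫ u, K t u * K' u s ∂μ) * f s ∂μ := by
  have habs : MemLp (fun s => ‖f s‖) 2 μ := (Lp.memLp f).norm
  filter_upwards [hK.op_ae_eq (hK'.op f), hK.ae_integrable (hK'.abs.memLp_integral habs)]
    with t ht hint
  have h1 : ∀ᵐ u ∂μ, K t u * hK'.op f u = ∫ s, K t u * K' u s * f s ∂μ := by
    filter_upwards [hK'.op_ae_eq f] with u hu
    rw [hu, ← integral_const_mul]
    simp only [mul_assoc]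
  have hm : AEStronglyMeasurable (fun p : ℝ × ℝ => K t p.1 * K' p.1 p.2 * f p.2) (μ.prod μ) := by
    simp only [mul_assoc]
    exact ((hK.measurable_left t).comp measurable_fst).aestronglyMeasurable.mul
      (hK'.aestronglyMeasurable_mul (Lp.aestronglyMeasurable f))
  have hprod : Integrable (fun p : ℝ × ℝ => K t p.1 * K' p.1 p.2 * f p.2) (μ.prod μ) := by
    refine (integrable_prod_iff hm).2 ⟨?_, ?_⟩
    · filter_upwards [hK'.ae_integrable (Lp.memLp f)] with u hu
      simpa only [mul_assoc] using hu.const_mul (K t u)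
    · refine hint.norm.congr (Filter.Eventually.of_forall fun u => ?_)
      simp only [norm_mul, mul_assoc]
      rw [integral_const_mul]
      congr 1
      rw [Real.norm_of_nonneg (integral_nonneg fun s => by positivity)]
      simp only [Real.norm_eq_abs]
  rw [ht, integral_congr_ae h1, integral_integral_swap hprod]
  simp only [integral_mul_const]

end IsL2Kernel

end CCMFBm

end

noncomputable section

namespace CCMFBm

open scoped NNReal

/-! ### The Beta integral and growth of the Gamma function -/

theorem integral_rpow_mul_rpow_sub {u v x : ℝ} (hu : 0 < u) (hv : 0 < v) (hx : 0 < x) :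
    ∫ t in (0 : ℝ)..x, t ^ (u - 1) * (x - t) ^ (v - 1) =
      x ^ (u + v - 1) * (Real.Gamma u * Real.Gamma v / Real.Gamma (u + v)) := by
  have h := Complex.betaIntegral_scaled (u : ℂ) (v : ℂ) hx
  rw [Complex.betaIntegral_eq_Gamma_mul_div _ _ (by simpa) (by simpa)] at h
  have h1 : ∫ t in (0 : ℝ)..x, (t : ℂ) ^ ((u : ℂ) - 1) * ((x : ℂ) - t) ^ ((v : ℂ) - 1) =
      ∫ t in (0 : ℝ)..x, ((t ^ (u - 1) * (x - t) ^ (v - 1) : ℝ) : ℂ) := by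
    refine intervalIntegral.integral_congr fun t ht => ?_
    rw [uIcc_of_le hx.le] at ht
    rw [Complex.ofReal_mul, Complex.ofReal_cpow ht.1, Complex.ofReal_cpow (by linarith [ht.2])]
    push_cast
    rfl
  rw [h1, intervalIntegral.integral_ofReal] at h
  apply Complex.ofReal_injective
  rw [h, Complex.ofReal_mul, Complex.ofReal_cpow hx.le]
  push_cast
  rw [← Complex.Gamma_ofReal, ← Complex.Gamma_ofReal, ← Complex.Gamma_ofReal]
  push_cast
  rfl

theorem intervalIntegrable_rpow_mul_rpow_sub {u v x : ℝ} (hu : 0 < u) (hv : 0 < v) (hx : 0 < x) :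
    IntervalIntegrable (fun t => t ^ (u - 1) * (x - t) ^ (v - 1)) volume 0 x := by
  -- A non-integrable function would have integral 0 by convention, while the Beta value is
  -- positive.
  refine intervalIntegral.intervalIntegrable_of_integral_ne_zero ?_
  rw [integral_rpow_mul_rpow_sub hu hv hx]
  have := Real.Gamma_pos_of_pos hu
  have := Real.Gamma_pos_of_pos hv
  have := Real.Gamma_pos_of_pos (add_pos hu hv)
  positivity

/-- Only the part of the Gamma integral over (A, A + 1] is kept. As A is arbitrary, Γ outgrows every
exponential. -/
theorem rpow_mul_exp_le_Gamma {A y : ℝ} (hA : 0 < A) (hy : 1 ≤ y) :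
    A ^ (y - 1) * Real.exp (-(A + 1)) ≤ Real.Gamma y := by
  rw [Real.Gamma_eq_integral (by linarith)]
  have hint := Real.GammaIntegral_convergent (s := y) (by linarith)
  have hsub : Ioc A (A + 1) ⊆ Ioi 0 := fun x hx => hA.trans hx.1
  calc A ^ (y - 1) * Real.exp (-(A + 1))
      = ∫ _ in Ioc A (A + 1), A ^ (y - 1) * Real.exp (-(A + 1)) := by simp
    _ ≤ ∫ x in Ioc A (A + 1), Real.exp (-x) * x ^ (y - 1) := by
        refine setIntegral_mono_on (integrableOn_const (by simp)) (hint.mono_set hsub)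
          measurableSet_Ioc fun x hx => ?_
        rw [mul_comm]
        have h1 : A ^ (y - 1) ≤ x ^ (y - 1) :=
          Real.rpow_le_rpow hA.le hx.1.le (by linarith)
        have h2 : Real.exp (-(A + 1)) ≤ Real.exp (-x) := Real.exp_le_exp.2 (by linarith [hx.2])
        gcongr
    _ ≤ ∫ x in Ioi 0, Real.exp (-x) * x ^ (y - 1) := by
        refine setIntegral_mono_set hint ?_ hsub.eventuallyLE
        filter_upwards [ae_restrict_mem measurableSet_Ioi] with x hx
        have : (0 : ℝ) < x := hx
        simp only [Pi.zero_apply]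
        positivity

theorem summable_pow_div_Gamma {α : ℝ} (hα : 0 < α) {y : ℝ} (hy : 0 ≤ y) :
    Summable fun k : ℕ => y ^ (k + 1) / Real.Gamma ((k + 1 : ℕ) * α) := by
  -- Chosen so that A^α = 2y + 1: the series is then dominated by a geometric one of ratio y/(2y +
  -- 1) < 1.
  set A : ℝ := (2 * y + 1) ^ (1 / α) with hAdef
  have hApos : 0 < A := by positivity
  have hAα : A ^ α = 2 * y + 1 := by
    rw [hAdef, ← Real.rpow_mul (by positivity), one_div_mul_cancel hα.ne', Real.rpow_one]
  have hr : y / (2 * y + 1) < 1 := by rw [div_lt_one (by positivity)]; linarith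
  have hgeo : Summable fun k : ℕ => (A * Real.exp (A + 1)) * (y / (2 * y + 1)) ^ (k + 1) :=
    ((summable_nat_add_iff 1).2 (summable_geometric_of_lt_one (by positivity) hr)).mul_left _
  refine Summable.of_norm_bounded_eventually_nat hgeo ?_
  -- The lower bound for Γ needs (k + 1)α ≥ 1, which holds from N on.
  obtain ⟨N, hN⟩ := exists_nat_gt (1 / α)
  filter_upwards [Filter.eventually_ge_atTop N] with k hk
  have hk1 : 1 ≤ ((k + 1 : ℕ) : ℝ) * α := by
    have : (N : ℝ) ≤ k := by exact_mod_cast hk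
    rw [div_lt_iff₀ hα] at hN
    push_cast
    nlinarith
  have hG := rpow_mul_exp_le_Gamma hApos hk1
  have hGp : 0 < A ^ (((k + 1 : ℕ) : ℝ) * α - 1) * Real.exp (-(A + 1)) := by positivity
  rw [Real.norm_of_nonneg (div_nonneg (by positivity) (hGp.le.trans hG))]
  calc y ^ (k + 1) / Real.Gamma ((k + 1 : ℕ) * α)
      ≤ y ^ (k + 1) / (A ^ (((k + 1 : ℕ) : ℝ) * α - 1) * Real.exp (-(A + 1))) := by gcongr
    _ = _ := by
        rw [Real.rpow_sub hApos, mul_comm ((k + 1 : ℕ) : ℝ) α, Real.rpow_mul hApos.le, hAα,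
          Real.rpow_natCast, Real.rpow_one, Real.exp_neg, div_pow]
        field_simp

/-! ### The convolution powers of `x ↦ x ^ (α - 1)` and their resolvent -/

/-- The `k`-th convolution power of `z x ^ (α - 1) / Γ(α)`. -/
def mlTerm (α z : ℝ) (k : ℕ) (x : ℝ) : ℝ := z ^ k / Real.Gamma (k * α) * x ^ (k * α - 1)

/-- The resolvent of `z x ^ (α - 1) / Γ(α)`, a derivative of a Mittag-Leffler function. -/
def mlKer (α z x : ℝ) : ℝ := ∑' k : ℕ, mlTerm α z (k + 1) x

/-- The convolution product of functions on the half-line. -/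
def vconv (θ₁ θ₂ : ℝ → ℝ) (x : ℝ) : ℝ := ∫ v in (0 : ℝ)..x, θ₁ v * θ₂ (x - v)

theorem vconv_comm (θ₁ θ₂ : ℝ → ℝ) (x : ℝ) : vconv θ₁ θ₂ x = vconv θ₂ θ₁ x := by
  have h := intervalIntegral.integral_comp_sub_left (a := 0) (b := x)
    (fun v => θ₁ v * θ₂ (x - v)) x
  simp only [sub_sub_cancel, sub_self, sub_zero] at h
  rw [vconv, vconv, ← h]
  exact intervalIntegral.integral_congr fun v _ => mul_comm _ _

theorem measurable_mlTerm (α z : ℝ) (k : ℕ) : Measurable (mlTerm α z k) := by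
  unfold mlTerm
  fun_prop

theorem mlTerm_abs {α : ℝ} (hα : 0 < α) (z : ℝ) (k : ℕ) {x : ℝ} (hx : 0 ≤ x) :
    |mlTerm α z (k + 1) x| = mlTerm α |z| (k + 1) x := by
  have : 0 < Real.Gamma ((k + 1 : ℕ) * α) := Real.Gamma_pos_of_pos (by positivity)
  rw [mlTerm, mlTerm, abs_mul, abs_div, abs_pow, abs_of_pos this,
    abs_of_nonneg (Real.rpow_nonneg hx _)]

/-- The majorant of the `k`-th term of the resolvent on `(0, T]`. -/
def mlBound (α z T : ℝ) (k : ℕ) : ℝ :=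
  |z| ^ (k + 1) * T ^ (k * α) / Real.Gamma ((k + 1 : ℕ) * α)

theorem summable_mlBound {α : ℝ} (hα : 0 < α) (z : ℝ) {T : ℝ} (hT : 0 < T) :
    Summable (mlBound α z T) := by
  have h := (summable_pow_div_Gamma hα (y := |z| * T ^ α) (by positivity)).mul_left (T ^ (-α))
  refine h.congr fun k => ?_
  rw [mlBound, mul_pow, ← Real.rpow_natCast (T ^ α), ← Real.rpow_mul hT.le]
  have : T ^ (k * α) = T ^ (-α) * T ^ (α * ((k + 1 : ℕ) : ℝ)) := by
    rw [← Real.rpow_add hT]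
    congr 1
    push_cast
    ring
  rw [this]
  ring

theorem abs_mlTerm_le {α : ℝ} (hα : 0 < α) (z : ℝ) {T : ℝ} (k : ℕ) {x : ℝ}
    (hx : x ∈ Ioc 0 T) : |mlTerm α z (k + 1) x| ≤ mlBound α z T k * x ^ (α - 1) := by
  have : 0 < Real.Gamma ((k + 1 : ℕ) * α) := Real.Gamma_pos_of_pos (by positivity)
  rw [mlTerm_abs hα z k hx.1.le, mlTerm, mlBound]
  have h : x ^ (((k + 1 : ℕ) : ℝ) * α - 1) = x ^ (k * α) * x ^ (α - 1) := by
    rw [← Real.rpow_add hx.1]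
    congr 1
    push_cast
    ring
  have h2 : x ^ (k * α) ≤ T ^ (k * α) := Real.rpow_le_rpow hx.1.le hx.2 (by positivity)
  have h3 : 0 < x ^ (α - 1) := Real.rpow_pos_of_pos hx.1 _
  rw [h]
  calc |z| ^ (k + 1) / Real.Gamma ((k + 1 : ℕ) * α) * (x ^ (k * α) * x ^ (α - 1))
      ≤ |z| ^ (k + 1) / Real.Gamma ((k + 1 : ℕ) * α) * (T ^ (k * α) * x ^ (α - 1)) := by gcongr
    _ = _ := by ring

/-- Every real x is covered, the irrelevant x ≤ 0 included, so that the sum is a pointwise limit on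
ℝ and hence measurable. -/
theorem summable_mlTerm {α : ℝ} (hα : 0 < α) (z x : ℝ) :
    Summable fun k : ℕ => mlTerm α z (k + 1) x := by
  rcases eq_or_ne x 0 with rfl | hx
  · refine Summable.of_norm_bounded (summable_pow_div_Gamma hα (abs_nonneg z)) fun k => ?_
    have : 0 < Real.Gamma ((k + 1 : ℕ) * α) := Real.Gamma_pos_of_pos (by positivity)
    rw [Real.norm_eq_abs, mlTerm_abs hα z k le_rfl, mlTerm]
    refine mul_le_of_le_one_right (by positivity) ?_
    exact Real.zero_rpow_le_one _
  · have hx' : 0 < |x| := abs_pos.2 hx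
    refine Summable.of_norm_bounded
      ((summable_mlBound hα z hx').mul_right (|x| ^ (α - 1))) fun k => ?_
    refine le_trans ?_ (abs_mlTerm_le hα z k (x := |x|) ⟨hx', le_rfl⟩)
    rw [Real.norm_eq_abs, mlTerm, mlTerm, abs_mul, abs_mul]
    exact mul_le_mul_of_nonneg_left ((Real.abs_rpow_le_abs_rpow _ _).trans (le_abs_self _))
      (abs_nonneg _)

theorem measurable_mlKer {α : ℝ} (hα : 0 < α) (z : ℝ) : Measurable (mlKer α z) := by
  refine measurable_of_tendsto_metrizable (f := fun n x => ∑ k ∈ Finset.range n,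
    mlTerm α z (k + 1) x) (fun n => ?_) ?_
  · exact Finset.measurable_fun_sum _ fun k _ => measurable_mlTerm α z (k + 1)
  · rw [tendsto_pi_nhds]
    exact fun x => (summable_mlTerm hα z x).hasSum.tendsto_sum_nat

/-- The resolvent is no more singular at 0 than its first term, so one L² estimate serves both
operators. -/
theorem abs_mlKer_le {α : ℝ} (hα : 0 < α) (z : ℝ) {T x : ℝ} (hx : x ∈ Ioc 0 T) :
    |mlKer α z x| ≤ (∑' k, mlBound α z T k) * x ^ (α - 1) := by
  rw [← tsum_mul_right]
  refine tsum_of_norm_bounded (f := fun k => mlTerm α z (k + 1) x) ?_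
    fun k => abs_mlTerm_le hα z k hx
  exact ((summable_mlBound hα z (hx.1.trans_le hx.2)).mul_right _).hasSum

/-- Dividing by Γ(kα) absorbs the Beta constant, which makes the terms a convolution semigroup in k.
-/
theorem vconv_mlTerm {α : ℝ} (hα : 0 < α) (z : ℝ) (j k : ℕ) {x : ℝ} (hx : 0 < x) :
    vconv (mlTerm α z (j + 1)) (mlTerm α z (k + 1)) x = mlTerm α z (j + k + 2) x := by
  have hj : 0 < ((j + 1 : ℕ) : ℝ) * α := by positivity
  have hk : 0 < ((k + 1 : ℕ) : ℝ) * α := by positivity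
  have hGj := Real.Gamma_pos_of_pos hj
  have hGk := Real.Gamma_pos_of_pos hk
  have hsum : ((j + 1 : ℕ) : ℝ) * α + ((k + 1 : ℕ) : ℝ) * α = ((j + k + 2 : ℕ) : ℝ) * α := by
    push_cast
    ring
  have h := integral_rpow_mul_rpow_sub hj hk hx
  rw [hsum] at h
  have e : ∀ v : ℝ, mlTerm α z (j + 1) v * mlTerm α z (k + 1) (x - v) =
      z ^ (j + 1) / Real.Gamma ((j + 1 : ℕ) * α) * (z ^ (k + 1) / Real.Gamma ((k + 1 : ℕ) * α)) *
        (v ^ (((j + 1 : ℕ) : ℝ) * α - 1) * (x - v) ^ (((k + 1 : ℕ) : ℝ) * α - 1)) := fun v => by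
    simp only [mlTerm]
    ring
  simp only [vconv, e]
  rw [intervalIntegral.integral_const_mul, h, mlTerm]
  field_simp
  ring

theorem intervalIntegrable_mlTerm_mul {α : ℝ} (hα : 0 < α) (z : ℝ) (j k : ℕ) {x : ℝ}
    (hx : 0 < x) :
    IntervalIntegrable (fun v => mlTerm α z (j + 1) v * mlTerm α z (k + 1) (x - v)) volume 0 x := by
  have hj : 0 < ((j + 1 : ℕ) : ℝ) * α := by positivity
  have hk : 0 < ((k + 1 : ℕ) : ℝ) * α := by positivity
  refine ((intervalIntegrable_rpow_mul_rpow_sub hj hk hx).const_mul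
    (z ^ (j + 1) / Real.Gamma ((j + 1 : ℕ) * α) *
      (z ^ (k + 1) / Real.Gamma ((k + 1 : ℕ) * α)))).congr fun v _ => ?_
  simp only [mlTerm]
  ring

/-- The resolvent equation. -/
theorem vconv_mlTerm_one_mlKer {α : ℝ} (hα : 0 < α) (z : ℝ) {x : ℝ} (hx : 0 < x) :
    vconv (mlTerm α z 1) (mlKer α z) x = mlKer α z x - mlTerm α z 1 x := by
  have hint : ∀ k : ℕ, Integrable (fun v => mlTerm α z 1 v * mlTerm α z (k + 1) (x - v))
      (volume.restrict (Ioc 0 x)) := fun k =>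
    (intervalIntegrable_iff_integrableOn_Ioc_of_le hx.le).1
      (intervalIntegrable_mlTerm_mul hα z 0 k hx)
  have hnorm : ∀ k : ℕ, ∫ v in Ioc 0 x, ‖mlTerm α z 1 v * mlTerm α z (k + 1) (x - v)‖ =
      mlTerm α |z| (k + 2) x := fun k => by
    have h := vconv_mlTerm hα |z| 0 k hx
    rw [zero_add, zero_add] at h
    rw [← h, vconv, intervalIntegral.integral_of_le hx.le]
    refine setIntegral_congr_fun measurableSet_Ioc fun v hv => ?_
    simp only [norm_mul, Real.norm_eq_abs]
    have h1 := mlTerm_abs hα z 0 hv.1.le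
    rw [zero_add] at h1
    rw [h1, mlTerm_abs hα z k (by linarith [hv.2])]
  have hs : Summable fun k : ℕ => mlTerm α |z| (k + 2) x :=
    (summable_nat_add_iff 1).2 (summable_mlTerm hα |z| x)
  -- The L¹ norms of the summands are terms of the same series with |z| for z, so sum and integral
  -- may be exchanged.
  have h := integral_tsum_of_summable_integral_norm hint (by simpa only [hnorm] using hs)
  have hval : ∀ k : ℕ, ∫ v in Ioc 0 x, mlTerm α z 1 v * mlTerm α z (k + 1) (x - v) =
      mlTerm α z (k + 2) x := fun k => by
    have h := vconv_mlTerm hα z 0 k hx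
    rw [zero_add, zero_add] at h
    rw [← h, vconv, intervalIntegral.integral_of_le hx.le]
  simp only [hval, tsum_mul_left] at h
  rw [vconv, intervalIntegral.integral_of_le hx.le]
  change ∫ v in Ioc 0 x, mlTerm α z 1 v * ∑' k : ℕ, mlTerm α z (k + 1) (x - v) = _
  -- Convolution with the first term shifts the series by one, so exactly the first term is missing.
  rw [← h, mlKer, (summable_mlTerm hα z x).tsum_eq_zero_add]
  simp

end CCMFBm

end

noncomputable section

namespace CCMFBm

open scoped NNReal

/-! ### Weighted Volterra convolution kernels -/

/-- The kernel `t ^ (-α) s ^ α θ (s - t)`, `0 < t < s ≤ T`. -/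
def volterraKer (α T : ℝ) (θ : ℝ → ℝ) (t s : ℝ) : ℝ :=
  if 0 < t ∧ t < s ∧ s ≤ T then t ^ (-α) * s ^ α * θ (s - t) else 0

theorem measurable_volterraKer (α T : ℝ) {θ : ℝ → ℝ} (hθ : Measurable θ) :
    Measurable (Function.uncurry (volterraKer α T θ)) := by
  refine Measurable.ite ?_ (by fun_prop) measurable_const
  exact (measurableSet_lt measurable_const measurable_fst).inter
    ((measurableSet_lt measurable_fst measurable_snd).inter
      (measurableSet_le measurable_snd measurable_const))

theorem volterraKer_congr {α T : ℝ} {θ₁ θ₂ : ℝ → ℝ} (h : ∀ x, 0 < x → θ₁ x = θ₂ x) (t s : ℝ) :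
    volterraKer α T θ₁ t s = volterraKer α T θ₂ t s := by
  unfold volterraKer
  split_ifs with hc
  · rw [h _ (sub_pos.2 hc.2.1)]
  · rfl

theorem volterraKer_sub (α T : ℝ) (θ₁ θ₂ : ℝ → ℝ) (t s : ℝ) :
    volterraKer α T (fun x => θ₁ x - θ₂ x) t s =
      volterraKer α T θ₁ t s - volterraKer α T θ₂ t s := by
  unfold volterraKer
  split_ifs <;> ring

theorem ae_leb_pos (T : ℝ) : ∀ᵐ t ∂leb T, 0 < t ∧ t < T := by
  have h1 : ∀ᵐ t ∂leb T, t ∈ Icc 0 T := ae_restrict_mem measurableSet_Icc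
  have h2 : ∀ᵐ t ∂leb T, t ≠ 0 := ae_restrict_of_ae (Measure.ae_ne volume 0)
  have h3 : ∀ᵐ t ∂leb T, t ≠ T := ae_restrict_of_ae (Measure.ae_ne volume T)
  filter_upwards [h1, h2, h3] with t a b c
  exact ⟨lt_of_le_of_ne a.1 (Ne.symm b), lt_of_le_of_ne a.2 c⟩

theorem lintegral_indicator_leb_le {T a b : ℝ} (hab : a ≤ b) {f : ℝ → ℝ}
    (hf : IntervalIntegrable f volume a b) (h0 : ∀ x ∈ Ioc a b, 0 ≤ f x) :
    ∫⁻ x, (Ioc a b).indicator (fun x => ENNReal.ofReal (f x)) x ∂leb T ≤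
      ENNReal.ofReal (∫ x in a..b, f x) := by
  rw [intervalIntegral.integral_of_le hab, ofReal_integral_eq_lintegral_ofReal
    ((intervalIntegrable_iff_integrableOn_Ioc_of_le hab).1 hf)
    ((ae_restrict_iff' measurableSet_Ioc).2 (Filter.Eventually.of_forall h0)),
    ← lintegral_indicator measurableSet_Ioc]
  exact lintegral_mono' Measure.restrict_le_self le_rfl

theorem intervalIntegrable_sub_rpow {α : ℝ} (hα : 0 < α) (t b : ℝ) :
    IntervalIntegrable (fun s => (s - t) ^ (α - 1)) volume t b := by
  have h := (intervalIntegral.intervalIntegrable_rpow' (a := 0) (b := b - t) (r := α - 1)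
    (by linarith)).comp_sub_right t
  simpa using h

/-- Schur's test with weight s^{−α}. Integrating in s, the weight cancels s^α and leaves (s −
t)^{α−1}. Integrating in t, it produces t^{−2α}(s − t)^{α−1}, a Beta integral that is finite because
α < 1/2. -/
theorem isL2Kernel_volterraKer_rpow {α : ℝ} (hα : 0 < α) (hα2 : α < 1 / 2) {T : ℝ} (hT : 0 < T) :
    IsL2Kernel (leb T) (volterraKer α T fun x => x ^ (α - 1)) := by
  have hm := measurable_volterraKer α T (θ := fun x => x ^ (α - 1)) (by fun_prop)
  set B : ℝ := Real.Gamma (1 - 2 * α) * Real.Gamma α / Real.Gamma (1 - 2 * α + α) with hB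
  have hB0 : 0 ≤ B := by
    have := Real.Gamma_pos_of_pos hα
    have := Real.Gamma_pos_of_pos (show 0 < 1 - 2 * α by linarith)
    have := Real.Gamma_pos_of_pos (show 0 < 1 - 2 * α + α by linarith)
    positivity
  refine isL2Kernel_of_schur hm (w := fun s => ENNReal.ofReal (s ^ (-α))) (by fun_prop) ?_
    (T ^ α / α).toNNReal (B * T ^ α).toNNReal ?_ ?_
  · filter_upwards [ae_leb_pos T] with s hs
    have : 0 < s ^ (-α) := Real.rpow_pos_of_pos hs.1 _
    exact ⟨by simpa using this, ENNReal.ofReal_ne_top⟩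
  · filter_upwards [ae_leb_pos T] with t ht
    have ht0 := ht.1
    have e : ∀ s, ‖volterraKer α T (fun x => x ^ (α - 1)) t s‖ₑ * ENNReal.ofReal (s ^ (-α)) =
        (Ioc t T).indicator (fun s => ENNReal.ofReal (t ^ (-α) * (s - t) ^ (α - 1))) s := by
      intro s
      by_cases hs : s ∈ Ioc t T
      · have hs0 : 0 < s := ht0.trans hs.1
        have hst : 0 < s - t := sub_pos.2 hs.1
        rw [indicator_of_mem hs, volterraKer, if_pos ⟨ht0, hs.1, hs.2⟩,
          Real.enorm_of_nonneg (by positivity), ← ENNReal.ofReal_mul (by positivity)]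
        congr 1
        rw [Real.rpow_neg hs0.le]
        field_simp
      · rw [indicator_of_notMem hs, volterraKer, if_neg (fun h => hs ⟨h.2.1, h.2.2⟩)]
        simp
    simp only [e]
    refine (lintegral_indicator_leb_le ht.2.le ((intervalIntegrable_sub_rpow hα t T).const_mul _)
      fun x hx => ?_).trans ?_
    · have : 0 < x - t := sub_pos.2 hx.1
      positivity
    rw [intervalIntegral.integral_const_mul,
      intervalIntegral.integral_comp_sub_right (fun x => x ^ (α - 1)), sub_self,
      integral_rpow (Or.inl (by linarith)), sub_add_cancel, Real.zero_rpow hα.ne', sub_zero,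
      show ((T ^ α / α).toNNReal : ℝ≥0∞) = ENNReal.ofReal (T ^ α / α) from rfl,
      ← ENNReal.ofReal_mul (by positivity), mul_comm]
    have : (T - t) ^ α ≤ T ^ α := Real.rpow_le_rpow (by linarith) (by linarith) hα.le
    refine ENNReal.ofReal_le_ofReal ?_
    gcongr
  · filter_upwards [ae_leb_pos T] with s hs
    have hs0 := hs.1
    have e : ∀ t, ‖volterraKer α T (fun x => x ^ (α - 1)) t s‖ₑ * ENNReal.ofReal (t ^ (-α)) ≤
        (Ioc 0 s).indicator (fun t => ENNReal.ofReal
          (s ^ α * (t ^ (1 - 2 * α - 1) * (s - t) ^ (α - 1)))) t := by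
      intro t
      by_cases ht : 0 < t ∧ t < s
      · have ht0 : 0 < t := ht.1
        have hst : 0 < s - t := sub_pos.2 ht.2
        rw [indicator_of_mem (show t ∈ Ioc 0 s from ⟨ht.1, ht.2.le⟩), volterraKer, if_pos ⟨ht.1, ht.2, hs.2.le⟩,
          Real.enorm_of_nonneg (by positivity), ← ENNReal.ofReal_mul (by positivity)]
        apply le_of_eq
        congr 1
        rw [show 1 - 2 * α - 1 = -α + -α by ring, Real.rpow_add ht0]
        ring
      · rw [volterraKer, if_neg (fun h => ht ⟨h.1, h.2.1⟩)]
        simp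
    refine (lintegral_mono e).trans ((lintegral_indicator_leb_le hs0.le
      ((intervalIntegrable_rpow_mul_rpow_sub (by linarith) hα hs0).const_mul _)
      fun x hx => ?_).trans ?_)
    · have : 0 ≤ s - x := sub_nonneg.2 hx.2
      have := hx.1
      positivity
    rw [intervalIntegral.integral_const_mul, integral_rpow_mul_rpow_sub (by linarith) hα hs0, ← hB,
      show ((B * T ^ α).toNNReal : ℝ≥0∞) = ENNReal.ofReal (B * T ^ α) from rfl,
      ← ENNReal.ofReal_mul (by positivity), ← mul_assoc, ← Real.rpow_add hs0]
    refine ENNReal.ofReal_le_ofReal ?_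
    have h1 : s ^ α ≤ T ^ α := Real.rpow_le_rpow hs0.le hs.2.le hα.le
    have h2 : 0 < s ^ (-α) := Real.rpow_pos_of_pos hs0 _
    have h3 : s ^ α * s ^ (-α) = 1 := by rw [← Real.rpow_add hs0]; simp
    rw [show α + (1 - 2 * α + α - 1) = 0 by ring, Real.rpow_zero, one_mul]
    -- All powers of s have cancelled, leaving the constant B; the weight is restored at the cost of
    -- T^α.
    have h4 : 1 ≤ T ^ α * s ^ (-α) := h3 ▸ mul_le_mul_of_nonneg_right h1 h2.le
    calc B = B * 1 := (mul_one B).symm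
      _ ≤ B * (T ^ α * s ^ (-α)) := by gcongr
      _ = _ := by ring

theorem abs_volterraKer_le {α T M : ℝ} {θ : ℝ → ℝ} (hM : ∀ x ∈ Ioc 0 T, |θ x| ≤ M * x ^ (α - 1))
    (t s : ℝ) : |volterraKer α T θ t s| ≤ M * volterraKer α T (fun x => x ^ (α - 1)) t s := by
  unfold volterraKer
  split_ifs with h
  · have h0 : 0 < s := h.1.trans h.2.1
    have h1 := h.1
    have h2 := hM (s - t) ⟨sub_pos.2 h.2.1, by linarith [h.2.2]⟩
    rw [abs_mul, abs_of_nonneg (by positivity)]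
    calc t ^ (-α) * s ^ α * |θ (s - t)| ≤ t ^ (-α) * s ^ α * (M * (s - t) ^ (α - 1)) := by gcongr
      _ = _ := by ring
  · simp

theorem isL2Kernel_volterraKer {α : ℝ} (hα : 0 < α) (hα2 : α < 1 / 2) {T : ℝ} (hT : 0 < T)
    {θ : ℝ → ℝ} (hθ : Measurable θ) {M : ℝ} (hM : ∀ x ∈ Ioc 0 T, |θ x| ≤ M * x ^ (α - 1)) :
    IsL2Kernel (leb T) (volterraKer α T θ) :=
  ((isL2Kernel_volterraKer_rpow hα hα2 hT).const_mul M).of_le (measurable_volterraKer α T hθ)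
    (abs_volterraKer_le hM)

theorem volterraKer_eq_indicator {α T : ℝ} {θ : ℝ → ℝ} {t : ℝ} (ht : 0 < t) (s : ℝ) :
    volterraKer α T θ t s =
      (Ioc t T).indicator (fun s => t ^ (-α) * s ^ α * θ (s - t)) s := by
  unfold volterraKer
  by_cases hs : s ∈ Ioc t T
  · rw [indicator_of_mem hs, if_pos ⟨ht, hs.1, hs.2⟩]
  · rw [indicator_of_notMem hs, if_neg fun h => hs ⟨h.2.1, h.2.2⟩]

theorem volterraKer_mul_eq_indicator {α T : ℝ} {θ f : ℝ → ℝ} {t : ℝ} (ht : 0 < t) (s : ℝ) :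
    volterraKer α T θ t s * f s =
      (Ioc t T).indicator (fun s => t ^ (-α) * s ^ α * θ (s - t) * f s) s := by
  rw [volterraKer_eq_indicator ht]
  by_cases hs : s ∈ Ioc t T
  · rw [indicator_of_mem hs, indicator_of_mem hs]
  · rw [indicator_of_notMem hs, indicator_of_notMem hs, zero_mul]

theorem leb_restrict_Ioc {T t : ℝ} (ht : 0 ≤ t) :
    (leb T).restrict (Ioc t T) = volume.restrict (Ioc t T) := by
  rw [Measure.restrict_restrict measurableSet_Ioc]
  congr 1
  exact inter_eq_left.2 fun x hx => ⟨ht.trans hx.1.le, hx.2⟩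

theorem integral_volterraKer_mul {α T : ℝ} {θ f : ℝ → ℝ} {t : ℝ} (ht : 0 < t) (htT : t ≤ T) :
    ∫ s, volterraKer α T θ t s * f s ∂leb T =
      ∫ s in t..T, t ^ (-α) * s ^ α * θ (s - t) * f s := by
  simp only [volterraKer_mul_eq_indicator ht]
  rw [integral_indicator measurableSet_Ioc, leb_restrict_Ioc ht.le,
    intervalIntegral.integral_of_le htT]

theorem integrable_volterraKer_mul_iff {α T : ℝ} {θ f : ℝ → ℝ} {t : ℝ} (ht : 0 < t)
    (htT : t ≤ T) : Integrable (fun s => volterraKer α T θ t s * f s) (leb T) ↔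
      IntervalIntegrable (fun s => t ^ (-α) * s ^ α * θ (s - t) * f s) volume t T := by
  simp only [volterraKer_mul_eq_indicator ht]
  rw [integrable_indicator_iff measurableSet_Ioc, IntegrableOn, leb_restrict_Ioc ht.le,
    intervalIntegrable_iff_integrableOn_Ioc_of_le htT, IntegrableOn]

/-- On the support s^α ≤ T^α, and (s − t)^{α−1} is integrable. Holding for each fixed t, this makes
the kernels L(·,t) and L⁻¹(·,t) absolutely continuous apart from their jump. -/
theorem integrable_volterraKer {α : ℝ} (hα : 0 < α) {T : ℝ} {θ : ℝ → ℝ} (hθ : Measurable θ) {M : ℝ}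
    (hM : ∀ x ∈ Ioc 0 T, |θ x| ≤ M * x ^ (α - 1)) (t : ℝ) :
    Integrable (volterraKer α T θ t) := by
  have hmeas : ∀ {θ : ℝ → ℝ}, Measurable θ → Measurable (volterraKer α T θ t) :=
    fun h => (measurable_volterraKer α T h).comp measurable_prodMk_left
  by_cases ht : 0 < t ∧ t < T
  · refine Integrable.mono' (g := fun s => M * volterraKer α T (fun x => x ^ (α - 1)) t s) ?_
      (hmeas hθ).aestronglyMeasurable (Filter.Eventually.of_forall (abs_volterraKer_le hM t))
    refine Integrable.const_mul ?_ M
    have hI : Integrable ((Ioc t T).indicator fun s => t ^ (-α) * T ^ α * (s - t) ^ (α - 1)) := by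
      rw [integrable_indicator_iff measurableSet_Ioc]
      exact (intervalIntegrable_iff_integrableOn_Ioc_of_le ht.2.le).1
        ((intervalIntegrable_sub_rpow hα t T).const_mul _)
    refine hI.mono' (hmeas (by fun_prop)).aestronglyMeasurable
      (Filter.Eventually.of_forall fun s => ?_)
    rw [volterraKer_eq_indicator ht.1]
    by_cases hs : s ∈ Ioc t T
    · have h0 : 0 < s := ht.1.trans hs.1
      have h1 : 0 < s - t := sub_pos.2 hs.1
      have h2 := ht.1
      have h3 : s ^ α ≤ T ^ α := Real.rpow_le_rpow h0.le hs.2 hα.le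
      rw [indicator_of_mem hs, indicator_of_mem hs, Real.norm_of_nonneg (by positivity)]
      gcongr
    · rw [indicator_of_notMem hs, indicator_of_notMem hs, norm_zero]
  · have : volterraKer α T θ t = 0 := by
      funext s
      exact if_neg fun h => ht ⟨h.1, h.2.1.trans_le h.2.2⟩
    rw [this]
    exact integrable_zero _ _ _

/-- The weights u^α and u^{−α} at the intermediate point cancel, and u ↦ u − t turns the rest into a
convolution evaluated at s − t. -/
theorem integral_volterraKer_mul_volterraKer (α T : ℝ) (θ₁ θ₂ : ℝ → ℝ) (t s : ℝ) :
    ∫ u, volterraKer α T θ₁ t u * volterraKer α T θ₂ u s ∂leb T =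
      volterraKer α T (vconv θ₁ θ₂) t s := by
  by_cases h : 0 < t ∧ t < s ∧ s ≤ T
  · have e : ∀ u, volterraKer α T θ₁ t u * volterraKer α T θ₂ u s =
        (Ioo t s).indicator (fun u => t ^ (-α) * s ^ α * (θ₁ (u - t) * θ₂ (s - u))) u := by
      intro u
      by_cases hu : u ∈ Ioo t s
      · have hu0 : 0 < u := h.1.trans hu.1
        rw [indicator_of_mem hu, volterraKer, volterraKer,
          if_pos ⟨h.1, hu.1, hu.2.le.trans h.2.2⟩, if_pos ⟨hu0, hu.2, h.2.2⟩]
        have : u ^ α * u ^ (-α) = 1 := by rw [← Real.rpow_add hu0]; simp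
        linear_combination (t ^ (-α) * s ^ α * (θ₁ (u - t) * θ₂ (s - u))) * this
      · rw [indicator_of_notMem hu, volterraKer, volterraKer]
        split_ifs with h1 h2
        · exact absurd ⟨h1.2.1, h2.2.1⟩ hu
        all_goals simp
    simp only [e]
    have hsub : Ioo t s ∩ Icc 0 T = Ioo t s :=
      inter_eq_left.2 fun x hx => ⟨h.1.le.trans hx.1.le, hx.2.le.trans h.2.2⟩
    rw [integral_indicator measurableSet_Ioo, Measure.restrict_restrict measurableSet_Ioo, hsub,
      ← integral_Ioc_eq_integral_Ioo, ← intervalIntegral.integral_of_le h.2.1.le,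
      intervalIntegral.integral_const_mul, volterraKer, if_pos h, vconv]
    congr 1
    have := intervalIntegral.integral_comp_sub_right (a := t) (b := s)
      (fun v => θ₁ v * θ₂ (s - t - v)) t
    rw [sub_self] at this
    rw [← this]
    refine intervalIntegral.integral_congr fun u _ => ?_
    congr 2
    ring
  · rw [volterraKer, if_neg h]
    refine integral_eq_zero_of_ae (Filter.Eventually.of_forall fun u => ?_)
    simp only [volterraKer, Pi.zero_apply]
    split_ifs with h1 h2
    · exact absurd ⟨h1.1, h1.2.1.trans h2.2.1, h2.2.2⟩ h
    all_goals simp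

end CCMFBm

end

noncomputable section

namespace CCMFBm

open scoped NNReal Topology

/-! ### Stieltjes measures of functions with one jump and an absolutely continuous part -/

theorem boundedVariationOn_of_abs_sub_le {f G : ℝ → ℝ} {s : Set ℝ} (hG : BoundedVariationOn G s)
    (h : ∀ x ∈ s, ∀ y ∈ s, x ≤ y → |f y - f x| ≤ G y - G x) : BoundedVariationOn f s := by
  refine ne_top_of_le_ne_top hG (iSup_mono fun p => Finset.sum_le_sum fun i _ => ?_)
  rw [edist_dist, edist_dist]
  refine ENNReal.ofReal_le_ofReal ?_
  rw [Real.dist_eq, Real.dist_eq]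
  exact (h _ (p.2.2.2 i) _ (p.2.2.2 (i + 1)) (p.2.2.1 (Nat.le_succ i))).trans (le_abs_self _)

/-- The function with a jump of height `c` at `t` and absolutely continuous part of density `r`. -/
def jumpPrimitive (c t : ℝ) (r : ℝ → ℝ) (s : ℝ) : ℝ := (Ioi t).indicator (fun _ => c) s +
  ∫ u in Iic s, r u

theorem setIntegral_Iic_sub {r : ℝ → ℝ} (hr : Integrable r) {x y : ℝ} (hxy : x ≤ y) :
    (∫ u in Iic y, r u) - ∫ u in Iic x, r u = ∫ u in Ioc x y, r u := by
  rw [intervalIntegral.integral_Iic_sub_Iic hr.integrableOn hr.integrableOn,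
    intervalIntegral.integral_of_le hxy]

theorem boundedVariationOn_jumpPrimitive (c t : ℝ) {r : ℝ → ℝ} (hr : Integrable r) :
    BoundedVariationOn (jumpPrimitive c t r) univ := by
  have hind : ∀ x y : ℝ, x ≤ y → |(Ioi t).indicator (fun _ => c) y -
      (Ioi t).indicator (fun _ => c) x| ≤
      (Ioi t).indicator (fun _ => |c|) y - (Ioi t).indicator (fun _ => |c|) x := by
    intro x y hxy
    simp only [indicator_apply, mem_Ioi]
    split_ifs with h1 h2 h2
    · simp
    · simp
    · exact absurd (h2.trans_le hxy) h1
    · simp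
  -- The same function built from |c| and |r| is monotone and bounded, and its increments dominate.
  refine boundedVariationOn_of_abs_sub_le (G := jumpPrimitive |c| t fun u => |r u|) ?_ ?_
  · refine MonotoneOn.boundedVariationOn (C := |c| + ∫ u, |r u|) ?_ ?_
    · intro x _ y _ hxy
      have h1 := (abs_nonneg _).trans (hind x y hxy)
      have h2 := setIntegral_Iic_sub hr.abs hxy
      have h3 : 0 ≤ ∫ u in Ioc x y, |r u| := integral_nonneg fun u => abs_nonneg _
      simp only [jumpPrimitive]
      linarith
    · intro x _
      have h1 : 0 ≤ (Ioi t).indicator (fun _ => |c|) x := indicator_nonneg (fun _ _ => abs_nonneg _) x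
      have h2 : (Ioi t).indicator (fun _ => |c|) x ≤ |c| := indicator_le_self' (by simp) x
      have h3 : 0 ≤ ∫ u in Iic x, |r u| := integral_nonneg fun u => abs_nonneg _
      have h4 : ∫ u in Iic x, |r u| ≤ ∫ u, |r u| :=
        setIntegral_le_integral hr.abs (Filter.Eventually.of_forall fun u => abs_nonneg _)
      rw [jumpPrimitive, abs_of_nonneg (by positivity)]
      linarith
  · intro x _ y _ hxy
    have h1 := setIntegral_Iic_sub hr hxy
    have h2 := setIntegral_Iic_sub hr.abs hxy
    have h3 : |∫ u in Ioc x y, r u| ≤ ∫ u in Ioc x y, |r u| := abs_integral_le_integral_abs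
    simp only [jumpPrimitive]
    calc _ = |((Ioi t).indicator (fun _ => c) y - (Ioi t).indicator (fun _ => c) x) +
          ((∫ u in Iic y, r u) - ∫ u in Iic x, r u)| := by congr 1; ring
      _ ≤ _ := abs_add_le _ _
      _ ≤ _ := by
        rw [h1]
        linarith [hind x y hxy]

theorem continuous_setIntegral_Iic {r : ℝ → ℝ} (hr : Integrable r) :
    Continuous fun s => ∫ u in Iic s, r u := by
  have h : (fun s => ∫ u in Iic s, r u) = fun s => (∫ u in Iic (0 : ℝ), r u) +
      ∫ u in (0 : ℝ)..s, r u := by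
    funext s
    rw [← intervalIntegral.integral_Iic_sub_Iic hr.integrableOn hr.integrableOn]
    ring
  rw [h]
  exact continuous_const.add
    (intervalIntegral.continuous_primitive (fun a b => hr.intervalIntegrable) 0)

/-- The jump occurs just after t, so the right limit at t already contains it; this places the atom
of the Stieltjes measure at t itself. -/
theorem rightLim_jumpPrimitive (c t : ℝ) {r : ℝ → ℝ} (hr : Integrable r) (s : ℝ) :
    Function.rightLim (jumpPrimitive c t r) s =
      (Ici t).indicator (fun _ => c) s + ∫ u in Iic s, r u := by
  refine rightLim_eq_of_tendsto ?_
  refine Filter.Tendsto.add ?_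
    ((continuous_setIntegral_Iic hr).continuousAt.tendsto.mono_left nhdsWithin_le_nhds)
  refine tendsto_const_nhds.congr' ?_
  rcases le_or_gt t s with h | h
  · filter_upwards [self_mem_nhdsWithin] with x hx
    rw [indicator_of_mem (show s ∈ Ici t from h),
      indicator_of_mem (show x ∈ Ioi t from lt_of_le_of_lt h hx)]
  · filter_upwards [nhdsWithin_le_nhds (Iio_mem_nhds h)] with x hx
    rw [indicator_of_notMem (show s ∉ Ici t from not_le.2 h),
      indicator_of_notMem (show x ∉ Ioi t from fun hx' => lt_asymm (show x < t from hx) hx')]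

/-- The two measures agree on the π-system of half-open intervals and have equal total mass; the
latter is read off from the function being constant on each side of [t, T]. -/
theorem vectorMeasure_jumpPrimitive {c t T : ℝ} (htT : t < T) {r : ℝ → ℝ} (hr : Integrable r)
    (hsupp : ∀ s ∉ Ioc t T, r s = 0) (h : BoundedVariationOn (jumpPrimitive c t r) univ) :
    h.vectorMeasure = VectorMeasure.dirac t c + volume.withDensityᵥ r := by
  refine VectorMeasure.ext_of_generateFrom {s | ∃ u v, u ≤ v ∧ s = Ioc u v} ?_ ?_ ?_ ?_
  · rintro _ ⟨u, v, huv, rfl⟩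
    rw [h.vectorMeasure_Ioc huv, rightLim_jumpPrimitive c t hr, rightLim_jumpPrimitive c t hr,
      _root_.add_apply, withDensityᵥ_apply hr measurableSet_Ioc,
      ← setIntegral_Iic_sub hr huv]
    have : VectorMeasure.dirac t c (Ioc u v) = (Ici t).indicator (fun _ => c) v -
        (Ici t).indicator (fun _ => c) u := by
      by_cases h1 : t ∈ Ioc u v
      · rw [VectorMeasure.dirac_apply_of_mem measurableSet_Ioc h1,
          indicator_of_mem (show v ∈ Ici t from h1.2),
          indicator_of_notMem (show u ∉ Ici t from not_le.2 h1.1), sub_zero]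
      · rw [VectorMeasure.dirac_apply_of_notMem h1]
        simp only [indicator_apply, mem_Ici]
        split_ifs with h2 h3 h3
        · simp
        · exact absurd ⟨not_le.1 h3, h2⟩ h1
        · exact absurd (h3.trans huv) h2
        · simp
    rw [this]
    ring
  · rw [BorelSpace.measurable_eq (α := ℝ), borel_eq_generateFrom_Ioc_le]
    congr 1
    ext s
    simp only [mem_ofPred_eq]
    constructor
    · rintro ⟨u, v, h1, h2⟩; exact ⟨u, v, h1, h2.symm⟩
    · rintro ⟨u, v, h1, h2⟩; exact ⟨u, v, h1, h2.symm⟩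
  · rintro _ ⟨u, v, huv, rfl⟩ _ ⟨u', v', huv', rfl⟩ hne
    rw [Ioc_inter_Ioc] at hne ⊢
    exact ⟨_, _, (nonempty_Ioc.1 hne).le, rfl⟩
  · have htop : Filter.Tendsto (jumpPrimitive c t r) Filter.atTop (𝓝 (c + ∫ u, r u)) := by
      refine tendsto_const_nhds.congr' ?_
      filter_upwards [Filter.eventually_ge_atTop T] with s hs
      rw [jumpPrimitive, indicator_of_mem (show s ∈ Ioi t from htT.trans_le hs),
        setIntegral_eq_integral_of_forall_compl_eq_zero]
      exact fun x hx => hsupp x fun hx' => hx (hx'.2.trans hs)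
    have hbot : Filter.Tendsto (jumpPrimitive c t r) Filter.atBot (𝓝 0) := by
      refine tendsto_const_nhds.congr' ?_
      filter_upwards [Filter.eventually_le_atBot t] with s hs
      rw [jumpPrimitive, indicator_of_notMem (show s ∉ Ioi t from not_lt.2 hs),
        setIntegral_eq_zero_of_forall_eq_zero, add_zero]
      exact fun x hx => hsupp x fun hx' => absurd hx'.1 (not_lt.2 (le_trans hx hs))
    rw [h.vectorMeasure_univ, htop.limUnder_eq, hbot.limUnder_eq, _root_.add_apply,
      VectorMeasure.dirac_apply_of_mem MeasurableSet.univ (mem_univ t),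
      withDensityᵥ_apply hr MeasurableSet.univ, setIntegral_univ, sub_zero]

theorem restrict_dirac_add_withDensity {c t T : ℝ} (htT : t < T) {r : ℝ → ℝ} (hr : Integrable r)
    (hsupp : ∀ s ∉ Ioc t T, r s = 0) :
    (VectorMeasure.dirac t c + volume.withDensityᵥ r).restrict (Icc t T) =
      VectorMeasure.dirac t c + volume.withDensityᵥ r := by
  ext E hE
  have hEI := hE.inter (measurableSet_Icc (a := t) (b := T))
  rw [VectorMeasure.restrict_apply _ measurableSet_Icc hE, _root_.add_apply,
    _root_.add_apply, withDensityᵥ_apply hr hEI, withDensityᵥ_apply hr hE]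
  congr 1
  · by_cases ht : t ∈ E
    · rw [VectorMeasure.dirac_apply_of_mem hE ht,
        VectorMeasure.dirac_apply_of_mem hEI ⟨ht, left_mem_Icc.2 htT.le⟩]
    · rw [VectorMeasure.dirac_apply_of_notMem ht,
        VectorMeasure.dirac_apply_of_notMem fun h => ht h.1]
  · refine (setIntegral_eq_of_subset_of_forall_sdiff_eq_zero hE inter_subset_left
      fun x hx => hsupp x fun hx' => hx.2 ⟨hx.1, Ioc_subset_Icc_self hx'⟩).symm

/-- Used for r and −r: only r g has to be integrable for g to be integrable against both parts of r
ds. -/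
theorem integrable_integral_withDensity_ofReal {r g : ℝ → ℝ} (hrm : Measurable r)
    (hg : Integrable fun s => r s * g s) :
    Integrable g (volume.withDensity fun s => ENNReal.ofReal (r s)) ∧
      ∫ s, g s ∂(volume.withDensity fun s => ENNReal.ofReal (r s)) = ∫ s, max (r s) 0 * g s ∧
      Integrable fun s => max (r s) 0 * g s := by
  have hI : Integrable fun s => max (r s) 0 * g s := by
    refine (hg.indicator (measurableSet_le measurable_const hrm :
      MeasurableSet {s | (0 : ℝ) ≤ r s})).congr (Filter.Eventually.of_forall fun s => ?_)
    change _ = max (r s) 0 * g s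
    by_cases h : 0 ≤ r s
    · rw [indicator_of_mem (show s ∈ {s | (0 : ℝ) ≤ r s} from h), max_eq_left h]
    · rw [indicator_of_notMem (show s ∉ {s | (0 : ℝ) ≤ r s} from h),
        max_eq_right (not_le.1 h).le, zero_mul]
  have hm : Measurable fun s => (r s).toNNReal := hrm.real_toNNReal
  refine ⟨?_, ?_, hI⟩
  · exact (integrable_withDensity_iff_integrable_smul hm).2 hI
  · exact integral_withDensity_eq_integral_smul hm g

theorem integrable_and_integral_dirac_add_withDensity {c t : ℝ} {r g : ℝ → ℝ} (hrm : Measurable r)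
    (hr : Integrable r) (hg : Integrable fun s => r s * g s) :
    (VectorMeasure.dirac t c + volume.withDensityᵥ r).Integrable g ∧
      (VectorMeasure.dirac t c + volume.withDensityᵥ r).integral g
        (ContinuousLinearMap.lsmul ℝ ℝ) = c * g t + ∫ s, r s * g s := by
  have hflip : (ContinuousLinearMap.lsmul ℝ ℝ : ℝ →L[ℝ] ℝ →L[ℝ] ℝ) =
      (ContinuousLinearMap.lsmul ℝ ℝ : ℝ →L[ℝ] ℝ →L[ℝ] ℝ).flip := by
    ext
    simp
  have hg' : Integrable fun s => -r s * g s := by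
    simpa only [neg_mul] using! hg.neg
  obtain ⟨p1, p2, p3⟩ := integrable_integral_withDensity_ofReal hrm hg
  obtain ⟨n1, n2, n3⟩ := integrable_integral_withDensity_ofReal (r := fun s => -r s) hrm.neg hg'
  have := isFiniteMeasure_withDensity_ofReal hr.2
  have := isFiniteMeasure_withDensity_ofReal hr.neg.2
  rw [withDensityᵥ_eq_withDensity_pos_part_sub_withDensity_neg_part hr]
  have hd : (VectorMeasure.dirac t c).Integrable g := by
    rw [VectorMeasure.Integrable, VectorMeasure.variation_dirac]
    exact (integrable_dirac (by simp)).smul_measure (by simp)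
  have hp : (volume.withDensity fun s => ENNReal.ofReal (r s)).toSignedMeasure.Integrable g := by
    rw [VectorMeasure.Integrable, Measure.variation_toSignedMeasure]
    exact p1
  have hn : (volume.withDensity fun s => ENNReal.ofReal (-r s)).toSignedMeasure.Integrable g := by
    rw [VectorMeasure.Integrable, Measure.variation_toSignedMeasure]
    exact n1
  refine ⟨hd.add_vectorMeasure (hp.sub_vectorMeasure hn), ?_⟩
  rw [VectorMeasure.integral_add_vectorMeasure hd (hp.sub_vectorMeasure hn),
    VectorMeasure.integral_sub_vectorMeasure hp hn, VectorMeasure.integral_dirac, hflip,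
    VectorMeasure.integral_toSignedMeasure, VectorMeasure.integral_toSignedMeasure, p2, n2,
    ← integral_sub p3 n3]
  congr 1
  refine integral_congr_ae (Filter.Eventually.of_forall fun s => ?_)
  simp only
  rw [← sub_mul]
  congr 1
  rcases le_total 0 (r s) with h | h
  · rw [max_eq_left h, max_eq_right (by simpa using h), sub_zero]
  · rw [max_eq_right h, max_eq_left (by simpa using h)]
    simp

/-- Integration against the Stieltjes measure of a function with a jump at the left endpoint and
an absolutely continuous part. -/
theorem stieltjes_integrableOn_and_integral {G r g : ℝ → ℝ} {c t T : ℝ} (htT : t < T)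
    (hrm : Measurable r) (hr : Integrable r) (hsupp : ∀ s ∉ Ioc t T, r s = 0)
    (hG : ∀ s, G (max t (min s T)) = jumpPrimitive c t r s)
    (hg : Integrable fun s => r s * g s) :
    (stieltjes G t T).IntegrableOn g (Icc t T) ∧
      ((stieltjes G t T).restrict (Icc t T)).integral g (ContinuousLinearMap.lsmul ℝ ℝ) =
        c * g t + ∫ s, r s * g s := by
  have hst : stieltjes G t T = VectorMeasure.dirac t c + volume.withDensityᵥ r := by
    have hfun : (fun s => G (max t (min s T))) = jumpPrimitive c t r := funext hG
    have hbv : BoundedVariationOn (fun s => G (max t (min s T))) univ := by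
      rw [hfun]
      exact boundedVariationOn_jumpPrimitive c t hr
    rw [stieltjes, dif_pos hbv]
    simp only [hfun]
    exact vectorMeasure_jumpPrimitive htT hr hsupp _
  rw [VectorMeasure.IntegrableOn, hst, restrict_dirac_add_withDensity htT hr hsupp]
  exact integrable_and_integral_dirac_add_withDensity hrm hr hg

end CCMFBm

end

noncomputable section

namespace CCMFBm

open scoped NNReal Topology

/-! ### The kernels `K_H`, `L` and `L⁻¹` as primitives of Volterra kernels -/

/-- The parameter of the resolvent kernel. -/
def resolventParam (a b H : ℝ) : ℝ := -(b / a) * cH H * Real.Gamma (H - 1 / 2)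

theorem setIntegral_Iic_volterraKer {α T : ℝ} (θ : ℝ → ℝ) {s t : ℝ} (hs : 0 < s) (htT : t ≤ T) :
    ∫ u in Iic t, volterraKer α T θ s u =
      if s < t then ∫ u in s..t, s ^ (-α) * u ^ α * θ (u - s) else 0 := by
  have hset : Iic t ∩ Ioc s T = Ioc s t := by
    ext x
    simp only [mem_inter_iff, mem_Iic, mem_Ioc]
    exact ⟨fun h => ⟨h.2.1, h.1⟩, fun h => ⟨h.2, h.1, h.2.trans htT⟩⟩
  simp only [volterraKer_eq_indicator hs]
  rw [setIntegral_indicator measurableSet_Ioc, hset]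
  split_ifs with h
  · rw [intervalIntegral.integral_of_le h.le]
  · rw [Ioc_eq_empty h, setIntegral_empty]

/-- The sign, (b/a)^k and the constants c(H)^k Γ(H − 1/2)^k combine into the k-th power of
`resolventParam`. -/
theorem LinvTerm_eq_setIntegral (a b H : ℝ) {s t T : ℝ} (hs : 0 < s) (htT : t ≤ T) (k : ℕ) :
    LinvTerm a b H t s k = ∫ u in Iic t,
      volterraKer (H - 1 / 2) T (mlTerm (H - 1 / 2) (resolventParam a b H) k) s u := by
  rw [setIntegral_Iic_volterraKer _ hs htT, LinvTerm, gam]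
  split_ifs with h
  · rw [← mul_assoc, ← intervalIntegral.integral_const_mul]
    refine intervalIntegral.integral_congr fun u _ => ?_
    simp only [mlTerm, resolventParam]
    rw [Real.rpow_neg hs.le, show -(b / a) * cH H * Real.Gamma (H - 1 / 2) =
      (-1) * (b / a) * cH H * Real.Gamma (H - 1 / 2) by ring, mul_pow, mul_pow, mul_pow]
    ring
  · simp

/-- Termwise integration: each kernel is at most a summable constant times one integrable kernel. -/
theorem hasSum_LinvTerm {a b H : ℝ} (hH : 1 / 2 < H) {s t T : ℝ} (hs : 0 < s) (htT : t ≤ T)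
    (hT : 0 < T) :
    HasSum (fun k : ℕ => LinvTerm a b H t s (k + 1)) (∫ u in Iic t,
      volterraKer (H - 1 / 2) T (mlKer (H - 1 / 2) (resolventParam a b H)) s u) := by
  set α := H - 1 / 2 with hαdef
  have hα : 0 < α := by linarith
  set z := resolventParam a b H
  have hint : ∀ k : ℕ, Integrable (volterraKer α T (mlTerm α z (k + 1)) s) := fun k =>
    integrable_volterraKer hα (measurable_mlTerm α z _)
      (fun x hx => abs_mlTerm_le hα z k hx) s
  have h0 : Integrable (volterraKer α T (fun x => x ^ (α - 1)) s) :=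
    integrable_volterraKer hα (by fun_prop) (M := 1)
      (fun x hx => by rw [one_mul, abs_of_nonneg (Real.rpow_nonneg hx.1.le _)]) s
  have hsum : Summable fun k : ℕ =>
      ∫ u in Iic t, ‖volterraKer α T (mlTerm α z (k + 1)) s u‖ := by
    refine Summable.of_nonneg_of_le (fun k => integral_nonneg fun u => norm_nonneg _) (fun k => ?_)
      ((summable_mlBound hα z hT).mul_right
        (∫ u in Iic t, volterraKer α T (fun x => x ^ (α - 1)) s u))
    rw [← integral_const_mul]
    exact integral_mono (hint k).norm.integrableOn (h0.const_mul _).integrableOn fun u =>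
      abs_volterraKer_le (fun x hx => abs_mlTerm_le hα z k hx) s u
  have h := hasSum_integral_of_summable_integral_norm
    (fun k => (hint k).integrableOn (s := Iic t)) hsum
  have e : ∀ u, ∑' k : ℕ, volterraKer α T (mlTerm α z (k + 1)) s u =
      volterraKer α T (mlKer α z) s u := fun u => by
    simp only [volterraKer]
    split_ifs
    · rw [tsum_mul_left, mlKer]
    · exact tsum_zero
  simp only [e] at h
  refine h.congr_fun fun k => ?_
  exact LinvTerm_eq_setIntegral a b H hs htT (k + 1)

theorem ind_eq_indicator_Ioi {s : ℝ} (hs : 0 ≤ s) (t : ℝ) :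
    ind t s = (Ioi s).indicator (fun _ => 1) t := by
  simp only [ind, indicator_apply, mem_Ico, mem_Ioi, hs, true_and]

theorem Linv_eq_jumpPrimitive {a b H : ℝ} (hH : 1 / 2 < H) {s t T : ℝ} (hs : 0 < s)
    (htT : t ≤ T) (hT : 0 < T) :
    Linv a b H t s = jumpPrimitive (1 / a) s (fun u => 1 / a *
      volterraKer (H - 1 / 2) T (mlKer (H - 1 / 2) (resolventParam a b H)) s u) t := by
  rw [Linv, (hasSum_LinvTerm hH hs htT hT).tsum_eq, jumpPrimitive, integral_const_mul,
    ind_eq_indicator_Ioi hs.le]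
  congr 1
  simp only [indicator_apply]
  split_ifs <;> simp

/-- Division by zero: 1 / 0^(H − 1/2) is 0. This lets summability and bounded variation include s =
0. -/
theorem gam_zero_right (H : ℝ) (hH : 1 / 2 < H) (k : ℕ) (t : ℝ) : gam H k t 0 = 0 := by
  unfold gam
  split_ifs
  · rw [Real.zero_rpow (by linarith)]
    simp
  · rfl

theorem summable_LinvTerm {a b H : ℝ} (hH : 1 / 2 < H) {s t T : ℝ} (hs : 0 ≤ s) (htT : t ≤ T)
    (hT : 0 < T) : Summable fun k : ℕ => LinvTerm a b H t s (k + 1) := by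
  rcases hs.eq_or_lt with rfl | hs
  · simp only [LinvTerm, gam_zero_right H hH, mul_zero]
    exact summable_zero
  · exact (hasSum_LinvTerm hH hs htT hT).summable

theorem integrable_volterraKer_mlKer {α : ℝ} (hα : 0 < α) (z T s : ℝ) :
    Integrable (volterraKer α T (mlKer α z) s) :=
  integrable_volterraKer hα (measurable_mlKer hα z) (fun _ hx => abs_mlKer_le hα z hx) s

theorem boundedVariationOn_Linv {a b H : ℝ} (hH : 1 / 2 < H) {s T : ℝ} (hs : 0 ≤ s)
    (hT : 0 < T) : BoundedVariationOn (fun t => Linv a b H t s) (Icc 0 T) := by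
  have key : ∀ r : ℝ → ℝ, Integrable r →
      (∀ t ∈ Icc 0 T, Linv a b H t s = jumpPrimitive (1 / a) s r t) →
      BoundedVariationOn (fun t => Linv a b H t s) (Icc 0 T) := fun r hr h => by
    rw [BoundedVariationOn, eVariationOn.congr (g := jumpPrimitive (1 / a) s r) h]
    exact (boundedVariationOn_jumpPrimitive (1 / a) s hr).mono (subset_univ _)
  rcases hs.eq_or_lt with rfl | hs
  · refine key 0 (integrable_zero _ _ _) fun t _ => ?_
    simp only [Linv, LinvTerm, gam_zero_right H hH, mul_zero, tsum_zero, add_zero, jumpPrimitive,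
      ind_eq_indicator_Ioi le_rfl, Pi.zero_apply, integral_zero, indicator_apply]
    split_ifs <;> simp
  · exact key _ ((integrable_volterraKer_mlKer (by linarith) _ T s).const_mul _) fun t ht =>
      Linv_eq_jumpPrimitive hH hs ht.2 hT

theorem gam_one {H : ℝ} (hH : 1 / 2 < H) (t s : ℝ) : gam H 1 t s = KH H t s := by
  unfold gam KH
  split_ifs with h
  · have hG : Real.Gamma (H - 1 / 2) ≠ 0 := (Real.Gamma_pos_of_pos (by linarith)).ne'
    simp only [pow_one, Nat.cast_one, one_mul]
    rw [mul_div_cancel_right₀ _ hG]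
    congr 1
    refine intervalIntegral.integral_congr fun u hu => ?_
    rw [uIcc_of_le h.le] at hu
    have e : (u - s) ^ (3 / 2 - H) = ((u - s) ^ (H - 1 / 2 - 1))⁻¹ := by
      rw [← Real.rpow_neg (by linarith [hu.1])]
      congr 1
      ring
    simp only [e, div_inv_eq_mul]
  · rfl

theorem KH_eq_setIntegral {a b H : ℝ} (ha : a ≠ 0) (hH : 1 / 2 < H) {s t T : ℝ} (hs : 0 < s)
    (htT : t ≤ T) : b * KH H t s = -a * ∫ u in Iic t,
      volterraKer (H - 1 / 2) T (mlTerm (H - 1 / 2) (resolventParam a b H) 1) s u := by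
  rw [← LinvTerm_eq_setIntegral a b H hs htT 1, LinvTerm, gam_one hH]
  field_simp

/-- Fundamental theorem of calculus: the integrand is singular at t but continuous at s > t. The
factor −a appears because `resolventParam` contains −b/a. -/
theorem mul_deriv_KH {a b H : ℝ} (ha : a ≠ 0) (hH : 1 / 2 < H) {t s : ℝ} (ht : 0 < t)
    (hts : t < s) : b * deriv (fun u => KH H u t) s = -a * (t ^ (-(H - 1 / 2)) * s ^ (H - 1 / 2) *
      mlTerm (H - 1 / 2) (resolventParam a b H) 1 (s - t)) := by
  set α := H - 1 / 2 with hαdef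
  have hα : 0 < α := by linarith
  have hst : 0 < s - t := sub_pos.2 hts
  have hs0 : 0 < s := ht.trans hts
  set φ : ℝ → ℝ := fun u => t ^ (-α) * u ^ α * mlTerm α (resolventParam a b H) 1 (u - t) with hφ
  have hφm : Measurable φ := by
    have := measurable_mlTerm α (resolventParam a b H) 1
    fun_prop
  have hint : IntervalIntegrable φ volume t s := by
    have h := integrable_volterraKer hα (T := s)
      (measurable_mlTerm α (resolventParam a b H) (0 + 1))
      (fun x hx => abs_mlTerm_le hα (resolventParam a b H) 0 hx) t
    rw [intervalIntegrable_iff_integrableOn_Ioc_of_le hts.le,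
      ← integrable_indicator_iff measurableSet_Ioc]
    exact h.congr (Filter.Eventually.of_forall fun u => volterraKer_eq_indicator ht u)
  have hcont : ContinuousAt φ s := by
    have h1 : ContinuousAt (fun u : ℝ => u ^ α) s :=
      Real.continuousAt_rpow_const _ _ (Or.inl hs0.ne')
    have h2 : ContinuousAt (fun u : ℝ => (u - t) ^ (((1 : ℕ) : ℝ) * α - 1)) s :=
      (Real.continuousAt_rpow_const _ _ (Or.inl hst.ne')).comp (f := fun u : ℝ => u - t)
        (by fun_prop)
    exact (continuousAt_const.mul h1).mul (continuousAt_const.mul h2)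
  have hd := (intervalIntegral.integral_hasDerivAt_right hint
    (hφm.stronglyMeasurable.stronglyMeasurableAtFilter) hcont).const_mul (-a)
  have heq : (fun u => b * KH H u t) =ᶠ[𝓝 s] fun u => -a * ∫ v in t..u, φ v := by
    filter_upwards [Ioi_mem_nhds hts] with u hu
    rw [KH_eq_setIntegral ha hH ht le_rfl, setIntegral_Iic_volterraKer _ ht le_rfl,
      if_pos (show t < u from hu)]
  rw [← deriv_const_mul_field, heq.deriv_eq, hd.deriv]

/-! ### The operator `L^*` and its inverse -/

theorem op_comp_volterraKer {α T : ℝ} {θ₁ θ₂ θ₃ θ₄ : ℝ → ℝ}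
    (h₁ : IsL2Kernel (leb T) (volterraKer α T θ₁)) (h₂ : IsL2Kernel (leb T) (volterraKer α T θ₂))
    (h₃ : IsL2Kernel (leb T) (volterraKer α T θ₃)) (h₄ : IsL2Kernel (leb T) (volterraKer α T θ₄))
    (h : ∀ x, 0 < x → vconv θ₁ θ₂ x = θ₃ x - θ₄ x) (f : L2 T) :
    h₁.op (h₂.op f) = h₃.op f - h₄.op f := by
  refine Lp.ext ?_
  filter_upwards [h₁.op_comp_ae_eq h₂ f, Lp.coeFn_sub (h₃.op f) (h₄.op f), h₃.op_ae_eq f,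
    h₄.op_ae_eq f, h₃.ae_integrable (Lp.memLp f), h₄.ae_integrable (Lp.memLp f)]
    with t e1 e2 e3 e4 i3 i4
  rw [e1, e2, Pi.sub_apply, e3, e4, ← integral_sub i3 i4]
  refine integral_congr_ae (Filter.Eventually.of_forall fun s => ?_)
  simp only
  rw [integral_volterraKer_mul_volterraKer, volterraKer_congr h, volterraKer_sub, sub_mul]

/-- The maps are a(I − E) and (1/a)(I + R). Both ER and RE equal R − E, by the resolvent equation
and commutativity of convolution, so they are two-sided inverses. -/
theorem exists_volterraEquiv {α : ℝ} (hα : 0 < α) (hα2 : α < 1 / 2) {T : ℝ} (hT : 0 < T) {a : ℝ}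
    (ha : a ≠ 0) (z : ℝ) : ∃ L : L2 T ≃L[ℝ] L2 T, ∀ (f : ℝ → ℝ) (hf : MemLp f 2 (leb T)),
      (L (hf.toLp f) =ᵐ[leb T] fun t =>
        a * f t - a * ∫ s, volterraKer α T (mlTerm α z 1) t s * f s ∂leb T) ∧
      (L.symm (hf.toLp f) =ᵐ[leb T] fun t =>
        1 / a * f t + 1 / a * ∫ s, volterraKer α T (mlKer α z) t s * f s ∂leb T) ∧
      (∀ᵐ t ∂leb T, Integrable (fun s => volterraKer α T (mlTerm α z 1) t s * f s) (leb T)) ∧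
      ∀ᵐ t ∂leb T, Integrable (fun s => volterraKer α T (mlKer α z) t s * f s) (leb T) := by
  have hE : IsL2Kernel (leb T) (volterraKer α T (mlTerm α z 1)) :=
    isL2Kernel_volterraKer hα hα2 hT (measurable_mlTerm α z 1)
      (fun x hx => abs_mlTerm_le hα z 0 hx)
  have hR : IsL2Kernel (leb T) (volterraKer α T (mlKer α z)) :=
    isL2Kernel_volterraKer hα hα2 hT (measurable_mlKer hα z) (fun x hx => abs_mlKer_le hα z hx)
  have hER := op_comp_volterraKer hE hR hR hE fun x hx => vconv_mlTerm_one_mlKer hα z hx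
  have hRE := op_comp_volterraKer hR hE hR hE fun x hx =>
    (vconv_comm _ _ x).trans (vconv_mlTerm_one_mlKer hα z hx)
  let A : L2 T →L[ℝ] L2 T := a • (ContinuousLinearMap.id ℝ _ - hE.op)
  let B : L2 T →L[ℝ] L2 T := (1 / a) • (ContinuousLinearMap.id ℝ _ + hR.op)
  have hA : ∀ f, A f = a • (f - hE.op f) := fun f => rfl
  have hB : ∀ f, B f = (1 / a) • (f + hR.op f) := fun f => rfl
  refine ⟨ContinuousLinearEquiv.equivOfInverse A B ?_ ?_, fun f hf => ⟨?_, ?_,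
    hE.ae_integrable hf, hR.ae_integrable hf⟩⟩
  · intro f
    rw [hB, hA, map_smul, map_sub, hRE, ← smul_add, smul_smul, one_div_mul_cancel ha, one_smul]
    abel
  · intro f
    rw [hA, hB, map_smul, map_add, hER, ← smul_sub, smul_smul, mul_one_div_cancel ha, one_smul]
    abel
  · change A (hf.toLp f) =ᵐ[leb T] _
    rw [hA]
    filter_upwards [Lp.coeFn_smul a (hf.toLp f - hE.op (hf.toLp f)),
      Lp.coeFn_sub (hf.toLp f) (hE.op (hf.toLp f)), hf.coeFn_toLp, hE.op_toLp_ae_eq hf]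
      with t e1 e2 e3 e4
    rw [e1, Pi.smul_apply, e2, Pi.sub_apply, e3, e4, smul_eq_mul, mul_sub]
  · change B (hf.toLp f) =ᵐ[leb T] _
    rw [hB]
    filter_upwards [Lp.coeFn_smul (1 / a) (hf.toLp f + hR.op (hf.toLp f)),
      Lp.coeFn_add (hf.toLp f) (hR.op (hf.toLp f)), hf.coeFn_toLp, hR.op_toLp_ae_eq hf]
      with t e1 e2 e3 e4
    rw [e1, Pi.smul_apply, e2, Pi.add_apply, e3, e4, smul_eq_mul, mul_add]

theorem mul_deriv_KH_eq {a b H : ℝ} (ha : a ≠ 0) (hH : 1 / 2 < H) {t T : ℝ}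
    (ht : 0 < t) (f : ℝ → ℝ) {s : ℝ} (hs : s ∈ Ioc t T) :
    b * (f s * deriv (fun u => KH H u t) s) = -a * (t ^ (-(H - 1 / 2)) * s ^ (H - 1 / 2) *
      mlTerm (H - 1 / 2) (resolventParam a b H) 1 (s - t) * f s) := by
  linear_combination f s * mul_deriv_KH (b := b) ha hH ht hs.1

theorem intervalIntegrable_mul_deriv_KH {a b H : ℝ} (ha : a ≠ 0) (hb : b ≠ 0) (hH : 1 / 2 < H)
    {t T : ℝ} (ht : 0 < t) (htT : t ≤ T) {f : ℝ → ℝ}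
    (hf : Integrable (fun s => volterraKer (H - 1 / 2) T
      (mlTerm (H - 1 / 2) (resolventParam a b H) 1) t s * f s) (leb T)) :
    IntervalIntegrable (fun s => f s * deriv (fun u => KH H u t) s) volume t T := by
  refine (((integrable_volterraKer_mul_iff ht htT).1 hf).const_mul (b⁻¹ * -a)).congr
    fun s hs => ?_
  rw [uIoc_of_le htT] at hs
  have h := mul_deriv_KH_eq (b := b) ha hH ht f hs
  rw [mul_assoc, ← h, inv_mul_cancel_left₀ hb]

theorem Lstar_eq {a b H : ℝ} (ha : a ≠ 0) (hH : 1 / 2 < H) {t T : ℝ} (ht : 0 < t) (htT : t ≤ T)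
    (f : ℝ → ℝ) : Lstar a b H T f t = a * f t - a * ∫ s, volterraKer (H - 1 / 2) T
      (mlTerm (H - 1 / 2) (resolventParam a b H) 1) t s * f s ∂leb T := by
  rw [Lstar, integral_volterraKer_mul ht htT, ← intervalIntegral.integral_const_mul, sub_eq_add_neg,
    ← neg_mul, ← intervalIntegral.integral_const_mul]
  congr 1
  refine intervalIntegral.integral_congr_ae (Filter.Eventually.of_forall fun s hs => ?_)
  rw [uIoc_of_le htT] at hs
  exact mul_deriv_KH_eq ha hH ht f hs

theorem setIntegral_Iic_clamp {r : ℝ → ℝ} {t T : ℝ} (hsupp : ∀ s ∉ Ioc t T, r s = 0) (s : ℝ) :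
    ∫ u in Iic (max t (min s T)), r u = ∫ u in Iic s, r u := by
  rw [← integral_indicator measurableSet_Iic, ← integral_indicator measurableSet_Iic]
  congr 1
  funext u
  by_cases hu : u ∈ Ioc t T
  · have : u ∈ Iic (max t (min s T)) ↔ u ∈ Iic s := by
      simp only [mem_Iic, le_max_iff, le_min_iff, hu.2, and_true, not_le.2 hu.1, false_or]
    simp only [indicator_apply, this]
  · simp only [indicator_apply, hsupp u hu, ite_self]

/-- The primitive is already constant to the left of t and to the right of T, so the extension built
into `stieltjes` does not alter it. -/
theorem jumpPrimitive_clamp {r : ℝ → ℝ} {c t T : ℝ} (htT : t < T)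
    (hsupp : ∀ s ∉ Ioc t T, r s = 0) (s : ℝ) :
    jumpPrimitive c t r (max t (min s T)) = jumpPrimitive c t r s := by
  have : max t (min s T) ∈ Ioi t ↔ s ∈ Ioi t := by
    simp only [mem_Ioi, lt_max_iff, lt_irrefl, lt_min_iff, htT, and_true, false_or]
  simp only [jumpPrimitive, setIntegral_Iic_clamp hsupp, indicator_apply, this]

/-- The atom at t contributes nothing, since f(s) − f(t) vanishes at s = t. The density part
contributes −f(t)/a times ∫ V, which cancels the same term in f(t) L⁻¹(T,t) and leaves (f + Rf)/a.
-/
theorem stieltjes_Linv {a b H : ℝ} (hH : 1 / 2 < H) {t T : ℝ} (ht : 0 < t) (htT : t < T)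
    {f : ℝ → ℝ} (hf : Integrable (fun s => volterraKer (H - 1 / 2) T
      (mlKer (H - 1 / 2) (resolventParam a b H)) t s * f s) (leb T)) :
    (stieltjes (fun s => Linv a b H s t) t T).IntegrableOn (fun s => f s - f t) (Icc t T) ∧
      LstarInv a b H T f t = 1 / a * f t + 1 / a * ∫ s, volterraKer (H - 1 / 2) T
        (mlKer (H - 1 / 2) (resolventParam a b H)) t s * f s ∂leb T := by
  set α := H - 1 / 2 with hαdef
  have hα : 0 < α := by linarith
  set V := volterraKer α T (mlKer α (resolventParam a b H)) t with hV
  have hVm : Measurable V :=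
    (measurable_volterraKer α T (measurable_mlKer hα _)).comp measurable_prodMk_left
  have hVi : Integrable V := integrable_volterraKer_mlKer hα _ T t
  have hV0 : ∀ s ∉ Ioc t T, V s = 0 := fun s hs => by
    rw [hV, volterraKer_eq_indicator ht, indicator_of_notMem hs]
  have hVf0 : ∀ s ∉ Icc 0 T, V s * f s = 0 := fun s hs => by
    rw [hV0 s fun h => hs ⟨ht.le.trans h.1.le, h.2⟩, zero_mul]
  have hVf : Integrable fun s => V s * f s :=
    (integrableOn_iff_integrable_of_support_subset
      (Function.support_subset_iff'.2 hVf0)).1 hf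
  have hg : Integrable fun s => 1 / a * V s * (f s - f t) := by
    refine ((hVf.sub (hVi.mul_const (f t))).const_mul (1 / a)).congr
      (Filter.Eventually.of_forall fun s => ?_)
    simp only [Pi.sub_apply]
    ring
  have hsupp : ∀ s ∉ Ioc t T, 1 / a * V s = 0 := fun s hs => by rw [hV0 s hs, mul_zero]
  have hT := ht.trans htT
  obtain ⟨h1, h2⟩ := stieltjes_integrableOn_and_integral (G := fun s => Linv a b H s t)
    (c := 1 / a) htT (hVm.const_mul (1 / a)) (hVi.const_mul (1 / a)) hsupp
    (fun s => by
      rw [Linv_eq_jumpPrimitive hH ht (max_le htT.le (min_le_right _ _)) hT]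
      exact jumpPrimitive_clamp htT hsupp s) hg
  refine ⟨h1, ?_⟩
  have h3 : Linv a b H T t = 1 / a + ∫ s, 1 / a * V s := by
    rw [Linv_eq_jumpPrimitive hH ht le_rfl hT, jumpPrimitive,
      indicator_of_mem (show T ∈ Ioi t from htT)]
    congr 1
    exact setIntegral_eq_integral_of_forall_compl_eq_zero fun s hs => hsupp s fun h => hs h.2
  rw [LstarInv, h2, h3, show ∫ s, V s * f s ∂leb T = ∫ s, V s * f s from
      setIntegral_eq_integral_of_forall_compl_eq_zero fun s hs => hVf0 s hs]
  have e : ∫ s, 1 / a * V s * (f s - f t) =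
      1 / a * ((∫ s, V s * f s) - (∫ s, V s) * f t) := by
    rw [← integral_mul_const, ← integral_sub hVf (hVi.mul_const _), ← integral_const_mul]
    refine integral_congr_ae (Filter.Eventually.of_forall fun s => ?_)
    simp only
    ring
  rw [e, integral_const_mul]
  ring

theorem integral_volterraKer_mul_ind {α T : ℝ} (θ : ℝ → ℝ) {s t : ℝ} (hs : 0 < s) :
    ∫ u, volterraKer α T θ s u * ind t u ∂leb T = ∫ u in Iic t, volterraKer α T θ s u := by
  have h0 : ∀ u ∉ Ioc s T, volterraKer α T θ s u = 0 := fun u hu => by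
    rw [volterraKer_eq_indicator hs, indicator_of_notMem hu]
  rw [setIntegral_eq_integral_of_forall_compl_eq_zero fun u hu => by
      rw [h0 u fun h => hu ⟨hs.le.trans h.1.le, h.2⟩, zero_mul],
    integral_Iic_eq_integral_Iio, ← integral_indicator measurableSet_Iio]
  congr 1
  funext u
  by_cases hu : u ∈ Ioc s T
  · simp only [ind, indicator_apply, mem_Ico, mem_Iio, (hs.trans hu.1).le, true_and]
    split_ifs <;> simp
  · simp only [indicator_apply, h0 u hu, zero_mul, ite_self]

end CCMFBm

end

noncomputable section

namespace CCMFBm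

open scoped Topology

/-! ### Totality of the indicators in `L²[0, T]` -/

theorem memLp_ind (T t : ℝ) : MemLp (ind t) 2 (leb T) :=
  memLp_indicator_const 2 measurableSet_Ico 1
    (Or.inr ((Measure.restrict_apply_le _ _).trans_lt measure_Ico_lt_top).ne)

theorem toLp_ind (T t : ℝ) : (memLp_ind T t).toLp (ind t) = indL2 T t := rfl

theorem inner_indL2 {T t s : ℝ} (ht : t ∈ Icc 0 T) (hs : s ∈ Icc 0 T) :
    inner ℝ (indL2 T t) (indL2 T s) = min t s := by
  have h : Ico 0 t ∩ Ico 0 s ∩ Icc 0 T = Ico 0 (min t s) := by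
    rw [Ico_inter_Ico, max_self]
    exact inter_eq_left.2 fun x hx => ⟨hx.1, (hx.2.trans_le (min_le_left _ _)).le.trans ht.2⟩
  rw [indL2, indL2, L2.inner_indicatorConstLp_indicatorConstLp]
  simp only [measureReal_def]
  rw [Measure.restrict_apply (measurableSet_Ico.inter measurableSet_Ico), h, Real.volume_Ico]
  rw [sub_zero, ENNReal.toReal_ofReal (le_min ht.1 hs.1)]
  simp

/-- The signed measure with density f vanishes on all half-lines, a generating π-system, hence is
zero. -/
theorem ae_eq_zero_of_forall_setIntegral_Ico {T : ℝ} (hT : 0 ≤ T) {f : ℝ → ℝ}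
    (hf : Integrable f (leb T)) (h : ∀ t ∈ Icc 0 T, ∫ x in Ico 0 t, f x ∂leb T = 0) :
    f =ᵐ[leb T] 0 := by
  have hfull : ∫ x, f x ∂leb T = 0 := by
    have h1 := h T ⟨hT, le_rfl⟩
    have h2 : (leb T).restrict (Ico 0 T) = leb T := by
      rw [Measure.restrict_restrict measurableSet_Ico, inter_eq_left.2 Ico_subset_Icc_self]
      exact (restrict_Ico_eq_restrict_Icc)
    rwa [h2] at h1
  refine hf.ae_eq_of_withDensityᵥ_eq (integrable_zero _ _ _) ?_
  rw [withDensityᵥ_zero]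
  refine VectorMeasure.ext_of_generateFrom (range Iio) ?_ ?_ isPiSystem_Iio ?_
  · rintro _ ⟨v, rfl⟩
    rw [withDensityᵥ_apply hf measurableSet_Iio, _root_.zero_apply]
    rcases le_or_gt v T with hv | hv
    · rcases le_or_gt v 0 with hv0 | hv0
      · have : (leb T).restrict (Iio v) = 0 := by
          rw [Measure.restrict_restrict measurableSet_Iio]
          have : Iio v ∩ Icc 0 T = ∅ := by
            ext x
            simp only [mem_inter_iff, mem_Iio, mem_Icc, mem_empty_iff_false, iff_false]
            intro hx
            linarith [hx.1, hx.2.1]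
          rw [this, Measure.restrict_empty]
        rw [this, integral_zero_measure]
      · have : (leb T).restrict (Iio v) = (leb T).restrict (Ico 0 v) := by
          rw [Measure.restrict_restrict measurableSet_Iio,
            Measure.restrict_restrict measurableSet_Ico]
          congr 1
          ext x
          simp only [mem_inter_iff, mem_Iio, mem_Icc, mem_Ico]
          tauto
        rw [this]
        exact h v ⟨hv0.le, hv⟩
    · have : (leb T).restrict (Iio v) = leb T := by
        rw [Measure.restrict_restrict measurableSet_Iio]
        congr 1
        exact inter_eq_right.2 fun x hx => lt_of_le_of_lt hx.2 hv
      rw [this, hfull]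
  · rw [BorelSpace.measurable_eq (α := ℝ), borel_eq_generateFrom_Iio]
  · rw [withDensityᵥ_apply hf MeasurableSet.univ, setIntegral_univ, hfull, _root_.zero_apply]

theorem eq_zero_of_forall_inner_indL2 {T : ℝ} (hT : 0 ≤ T) {f : L2 T}
    (h : ∀ t : Icc 0 T, inner ℝ (indL2 T t) f = 0) : f = 0 := by
  have hf : Integrable f (leb T) := (Lp.memLp f).integrable (by norm_num)
  rw [Lp.eq_zero_iff_ae_eq_zero]
  refine ae_eq_zero_of_forall_setIntegral_Ico hT hf fun t ht => ?_
  have := h ⟨t, ht⟩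
  rwa [indL2, L2.inner_indicatorConstLp_one] at this

theorem dense_span_indL2 {T : ℝ} (hT : 0 ≤ T) :
    Dense (Submodule.span ℝ (range fun t : Icc (0 : ℝ) T => indL2 T t) : Set (L2 T)) := by
  rw [Submodule.dense_iff_topologicalClosure_eq_top, Submodule.topologicalClosure_eq_top_iff,
    Submodule.eq_bot_iff]
  intro f hf
  exact eq_zero_of_forall_inner_indL2 hT fun t =>
    (Submodule.mem_orthogonal _ _).1 hf _ (Submodule.subset_span (mem_range_self t))

theorem clm_ext_indL2 {T : ℝ} (hT : 0 ≤ T) {F : Type*} [NormedAddCommGroup F] [NormedSpace ℝ F]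
    {A B : L2 T →L[ℝ] F} (h : ∀ t : Icc (0 : ℝ) T, A (indL2 T t) = B (indL2 T t)) : A = B :=
  ContinuousLinearMap.ext_on (dense_span_indL2 hT) (by rintro _ ⟨t, rfl⟩; exact h t)

/-! ### The integrand space and the Wiener integral -/

/-- The extension of a linear isometry to the completion of its domain. -/
def completionExtend {E F : Type*} [SeminormedAddCommGroup E] [NormedSpace ℝ E]
    [NormedAddCommGroup F] [NormedSpace ℝ F] [CompleteSpace F] (J : E →ₗᵢ[ℝ] F) :
    UniformSpace.Completion E →ₗᵢ[ℝ] F where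
  toFun := UniformSpace.Completion.extension J
  map_add' x y := by
    have hc := UniformSpace.Completion.continuous_extension (f := J)
    refine UniformSpace.Completion.induction_on₂ x y
      (isClosed_eq (hc.comp continuous_add)
        ((hc.comp continuous_fst).add (hc.comp continuous_snd))) fun a b => ?_
    rw [← UniformSpace.Completion.coe_add]
    simp only [UniformSpace.Completion.extension_coe J.isometry.uniformContinuous, map_add]
  map_smul' c x := by
    have hc := UniformSpace.Completion.continuous_extension (f := J)
    refine UniformSpace.Completion.induction_on x
      (isClosed_eq (hc.comp (continuous_const_smul c)) (hc.const_smul c)) fun a => ?_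
    rw [← UniformSpace.Completion.coe_smul]
    simp only [UniformSpace.Completion.extension_coe J.isometry.uniformContinuous, map_smul,
      RingHom.id_apply]
  norm_map' x := by
    have hc := UniformSpace.Completion.continuous_extension (f := J)
    change ‖UniformSpace.Completion.extension J x‖ = ‖x‖
    refine UniformSpace.Completion.induction_on x
      (isClosed_eq hc.norm continuous_norm) fun a => ?_
    rw [UniformSpace.Completion.extension_coe J.isometry.uniformContinuous, J.norm_map,
      UniformSpace.Completion.norm_coe]

theorem completionExtend_coe {E F : Type*} [SeminormedAddCommGroup E] [NormedSpace ℝ E]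
    [NormedAddCommGroup F] [NormedSpace ℝ F] [CompleteSpace F] (J : E →ₗᵢ[ℝ] F) (x : E) :
    completionExtend J x = J x :=
  UniformSpace.Completion.extension_coe J.isometry.uniformContinuous x

variable {Ω : Type*} [MeasurableSpace Ω] {P : Measure Ω} {T : ℝ}

/-- The hypothesis says that 1_t ↦ S 1_t is isometric on step functions. Its extension to Λ has
closed range, dense because S maps a dense set to a dense set, so it is onto; composing with S⁻¹
returns 1_t to 1_t. -/
theorem integrandSpaceEqL2_of_covFun (hT : 0 ≤ T) (Y : SquareIntegrableProcess P T)
    (S : L2 T ≃L[ℝ] L2 T)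
    (h : ∀ t s : Icc (0 : ℝ) T, covFun Y t s = inner ℝ (S (indL2 T t)) (S (indL2 T s))) :
    IntegrandSpaceEqL2 Y := by
  let J₀ : StepFn Y →ₗ[ℝ] L2 T :=
    Finsupp.linearCombination ℝ fun t : Icc (0 : ℝ) T => S (indL2 T t)
  have hJ₀ : ∀ t, J₀ (stepInd Y t) = S (indL2 T t) := fun t => by
    change Finsupp.linearCombination ℝ (fun t : Icc (0 : ℝ) T => S (indL2 T t))
      (Finsupp.single t 1) = _
    simp
  have hinner : ∀ c d : StepFn Y, stepInner Y c d = inner ℝ (J₀ c) (J₀ d) := fun c d => by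
    have e : ∀ e : StepFn Y, J₀ e = Finsupp.sum e fun t x => x • S (indL2 T t) :=
      fun e => Finsupp.linearCombination_apply ℝ e
    simp only [stepInner, e, Finsupp.sum, sum_inner, inner_sum, inner_smul_left, inner_smul_right,
      h, Finset.mul_sum, RCLike.conj_to_real]
    rw [Finset.sum_comm]
    exact Finset.sum_congr rfl fun _ _ => Finset.sum_congr rfl fun _ _ => by ring
  let J : StepFn Y →ₗᵢ[ℝ] L2 T :=
    { toLinearMap := J₀
      norm_map' := fun c => by
        have h : inner ℝ c c = inner ℝ (J₀ c) (J₀ c) := hinner c c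
        rw [real_inner_self_eq_norm_sq, real_inner_self_eq_norm_sq] at h
        exact ((sq_eq_sq₀ (norm_nonneg _) (norm_nonneg _)).1 h).symm }
  have hind : ∀ t, completionExtend J (indLam Y t) = S (indL2 T t) := fun t => by
    rw [indLam, completionExtend_coe]
    exact hJ₀ t
  have hdense : DenseRange (S.symm ∘ completionExtend J) := by
    refine (dense_span_indL2 hT).mono ?_
    let R : Submodule ℝ (L2 T) :=
      LinearMap.range (S.symm.toLinearEquiv.toLinearMap ∘ₗ (completionExtend J).toLinearMap)
    have : Submodule.span ℝ (range fun t : Icc (0 : ℝ) T => indL2 T t) ≤ R := by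
      rw [Submodule.span_le]
      rintro _ ⟨t, rfl⟩
      refine ⟨indLam Y t, ?_⟩
      change S.symm (completionExtend J (indLam Y t)) = _
      rw [hind, S.symm_apply_apply]
    exact this
  have hdense' : DenseRange (completionExtend J) := by
    have := S.surjective.denseRange.comp hdense S.continuous
    have e : S ∘ S.symm ∘ completionExtend J = completionExtend J := by
      funext x
      simp
    rwa [e] at this
  have hsurj : Function.Surjective (completionExtend J) := by
    rw [← range_eq_univ, ← hdense'.closure_range]
    exact ((completionExtend J).isometry.isClosedEmbedding.isClosed_range.closure_eq).symm
  refine ⟨(LinearIsometryEquiv.ofSurjective _ hsurj).toContinuousLinearEquiv.trans S.symm,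
    fun t => ?_⟩
  change S.symm (completionExtend J (indLam Y t)) = _
  rw [hind, S.symm_apply_apply]

/-- The Wiener integral as a bounded operator. -/
def wienerCLM (Y : SquareIntegrableProcess P T) (h : IntegrandSpaceEqL2 Y) :
    L2 T →L[ℝ] Lp ℝ 2 P :=
  (completionExtend (stepIsometry Y)).toContinuousLinearMap.comp
    (h.choose.symm : L2 T →L[ℝ] Lam Y)

theorem wienerIntegral_eq (Y : SquareIntegrableProcess P T) (h : IntegrandSpaceEqL2 Y) {f : ℝ → ℝ}
    (hf : MemLp f 2 (leb T)) : wienerIntegral Y f = wienerCLM Y h (hf.toLp f) := by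
  rw [wienerIntegral, dif_pos ⟨h, hf⟩]
  rfl

theorem wienerCLM_indL2 (Y : SquareIntegrableProcess P T) (h : IntegrandSpaceEqL2 Y)
    (t : Icc (0 : ℝ) T) : wienerCLM Y h (indL2 T t) = Y.toL2 t := by
  rw [← chaosMap_indLam, ← h.choose_spec t]
  change chaosMap Y (h.choose.symm (h.choose (indLam Y t))) = _
  rw [ContinuousLinearEquiv.symm_apply_apply]

/-- If I is the Wiener integral, I*I and the identity have the same matrix coefficients on the total
set of indicators. -/
theorem wienerCLM_inner {Y : SquareIntegrableProcess P T} (hT : 0 ≤ T) (h : IntegrandSpaceEqL2 Y)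
    (hcov : ∀ t s : Icc (0 : ℝ) T, covFun Y t s = inner ℝ (indL2 T t) (indL2 T s)) (f g : L2 T) :
    inner ℝ (wienerCLM Y h f) (wienerCLM Y h g) = inner ℝ f g := by
  have hA : (ContinuousLinearMap.adjoint (wienerCLM Y h)).comp (wienerCLM Y h) =
      ContinuousLinearMap.id ℝ (L2 T) := by
    refine clm_ext_indL2 hT fun s => ?_
    rw [← sub_eq_zero]
    refine eq_zero_of_forall_inner_indL2 hT fun t => ?_
    rw [inner_sub_right, ContinuousLinearMap.comp_apply, ContinuousLinearMap.adjoint_inner_right,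
      wienerCLM_indL2, wienerCLM_indL2, inner_toL2, hcov, ContinuousLinearMap.id_apply, sub_self]
  rw [← ContinuousLinearMap.adjoint_inner_right, ← ContinuousLinearMap.comp_apply, hA,
    ContinuousLinearMap.id_apply]

theorem covFun_brownian [IsProbabilityMeasure P] {W : SquareIntegrableProcess P T}
    (hW : IsBrownianMotion W) (t s : Icc (0 : ℝ) T) :
    covFun W t s = inner ℝ (indL2 T t) (indL2 T s) := by
  have h := covariance_eq_sub (W.memLp t) (W.memLp s)
  rw [hW.cov, hW.mean, zero_mul, sub_zero] at h
  rw [inner_indL2 t.2 s.2, h]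
  rfl

end CCMFBm

end

/-! ### The isomorphism for the mixed process and the transfer principle -/

noncomputable section

namespace CCMFBm

/-- The operator `L^*` with its values on indicators and its integral formulas. -/
theorem exists_LstarEquiv {T : ℝ} (hT : 0 < T) {a b H : ℝ} (ha : a ≠ 0) (hb : b ≠ 0)
    (hH : H ∈ Ioo (1 / 2 : ℝ) 1) : ∃ Ls : L2 T ≃L[ℝ] L2 T,
      (∀ t ∈ Icc 0 T, Ls (indL2 T t) =ᵐ[leb T] Lker a b H t) ∧
      (∀ t ∈ Icc 0 T, Ls.symm (indL2 T t) =ᵐ[leb T] Linv a b H t) ∧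
      ∀ (f : ℝ → ℝ) (hf : MemLp f 2 (leb T)),
        (∀ᵐ t ∂leb T,
          IntervalIntegrable (fun s => f s * deriv (fun u => KH H u t) s) volume t T) ∧
        (∀ᵐ t ∂leb T, (stieltjes (fun s => Linv a b H s t) t T).IntegrableOn
          (fun s => f s - f t) (Icc t T)) ∧
        Ls (hf.toLp f) =ᵐ[leb T] Lstar a b H T f ∧
        Ls.symm (hf.toLp f) =ᵐ[leb T] LstarInv a b H T f := by
  have hH1 : 1 / 2 < H := hH.1
  obtain ⟨Ls, hLs⟩ := exists_volterraEquiv (α := H - 1 / 2) (by linarith) (by linarith [hH.2]) hT ha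
    (resolventParam a b H)
  refine ⟨Ls, fun t ht => ?_, fun t ht => ?_, fun f hf => ?_⟩
  · have h := (hLs (ind t) (memLp_ind T t)).1
    rw [toLp_ind] at h
    filter_upwards [h, ae_leb_pos T] with s hs hs0
    rw [hs, integral_volterraKer_mul_ind _ hs0.1, Lker, KH_eq_setIntegral ha hH1 hs0.1 ht.2]
    ring
  · have h := (hLs (ind t) (memLp_ind T t)).2.1
    rw [toLp_ind] at h
    filter_upwards [h, ae_leb_pos T] with s hs hs0
    rw [hs, integral_volterraKer_mul_ind _ hs0.1, Linv,
      (hasSum_LinvTerm hH1 hs0.1 ht.2 hT).tsum_eq]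
  · obtain ⟨h1, h2, h3, h4⟩ := hLs f hf
    refine ⟨?_, ?_, ?_, ?_⟩
    · filter_upwards [h3, ae_leb_pos T] with t ht ht0
      exact intervalIntegrable_mul_deriv_KH ha hb hH1 ht0.1 ht0.2.le ht
    · filter_upwards [h4, ae_leb_pos T] with t ht ht0
      exact (stieltjes_Linv hH1 ht0.1 ht0.2 ht).1
    · filter_upwards [h1, ae_leb_pos T] with t ht ht0
      rw [ht, Lstar_eq ha hH1 ht0.1 ht0.2.le]
    · filter_upwards [h2, h4, ae_leb_pos T] with t ht ht4 ht0
      rw [ht, (stieltjes_Linv hH1 ht0.1 ht0.2 ht4).2]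

theorem memLp_and_toLp_of_ae_eq {T : ℝ} {g : ℝ → ℝ} {F : L2 T} (h : F =ᵐ[leb T] g) :
    ∃ hg : MemLp g 2 (leb T), hg.toLp g = F := by
  have hg : MemLp g 2 (leb T) := (memLp_congr_ae h).1 (Lp.memLp F)
  exact ⟨hg, Lp.ext (hg.coeFn_toLp.trans h.symm)⟩

theorem toL2_eq_wienerCLM {Ω : Type*} [MeasurableSpace Ω] {P : Measure Ω} {T a b H : ℝ} (hb : b ≠ 0)
    {W X : SquareIntegrableProcess P T} (hX : IsCCMFBm a b H W X) (hW : IntegrandSpaceEqL2 W)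
    {F : L2 T} {t : Icc (0 : ℝ) T} (hF : F =ᵐ[leb T] Lker a b H t) :
    X.toL2 t = wienerCLM W hW F := by
  obtain ⟨hL, rfl⟩ := memLp_and_toLp_of_ae_eq hF
  -- Without square integrability of K_H(t,·) the Wiener integral in the definition of X would be
  -- the default 0. It is obtained from K_H = b⁻¹(L − a 1_t).
  have hK : MemLp (fun s => KH H t s) 2 (leb T) := by
    have h := (hL.sub ((memLp_ind T t).const_mul a)).const_mul b⁻¹
    refine (memLp_congr_ae (Filter.Eventually.of_forall fun s => ?_)).1 h
    simp only [Pi.sub_apply, Lker]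
    field_simp
    ring
  have e : hL.toLp (Lker a b H t) = a • indL2 T t + b • hK.toLp _ := by
    rw [← toLp_ind, ← MemLp.toLp_const_smul, ← MemLp.toLp_const_smul, ← MemLp.toLp_add]
    rfl
  rw [e, map_add, map_smul, map_smul, wienerCLM_indL2, ← wienerIntegral_eq W hW hK]
  refine Lp.ext ?_
  filter_upwards [(X.memLp t).coeFn_toLp, hX t,
    Lp.coeFn_add (a • W.toL2 t) (b • wienerIntegral W fun s => KH H t s),
    Lp.coeFn_smul a (W.toL2 t), Lp.coeFn_smul b (wienerIntegral W fun s => KH H t s),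
    (W.memLp t).coeFn_toLp] with ω h1 h2 h3 h4 h5 h6
  rw [SquareIntegrableProcess.toL2, h1, h2, h3, Pi.add_apply, h4, h5, Pi.smul_apply, Pi.smul_apply,
    SquareIntegrableProcess.toL2, h6, smul_eq_mul, smul_eq_mul]

end CCMFBm

end

theorem mainTheorem2 {Ω : Type*} [MeasurableSpace Ω] (P : MeasureTheory.Measure Ω)
    [MeasureTheory.IsProbabilityMeasure P] (T : ℝ) (hT : 0 < T)
    (a b H : ℝ) (hab : a * b ≠ 0) (hH : H ∈ Set.Ioo (1 / 2 : ℝ) 1)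
    (W X : CCMFBm.SquareIntegrableProcess P T)
    (hW : CCMFBm.IsBrownianMotion W) (hX : CCMFBm.IsCCMFBm a b H W X) :
    -- the integrand spaces of `W` and of `X` are `L²[0, T]`
    CCMFBm.IntegrandSpaceEqL2 W ∧ CCMFBm.IntegrandSpaceEqL2 X ∧
    -- the series of `L⁻¹(t,s)` converges, and `L⁻¹(·,s)` is of bounded variation
    (∀ t ∈ Set.Icc 0 T, ∀ s ∈ Set.Icc 0 T,
      Summable fun k : ℕ => CCMFBm.LinvTerm a b H t s (k + 1)) ∧
    (∀ s ∈ Set.Icc 0 T, BoundedVariationOn (fun t => CCMFBm.Linv a b H t s) (Set.Icc 0 T)) ∧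
    -- `L^*`, the linear extension of `1_t ↦ L(t,·)`, is an isomorphism of `L²[0, T]`
    ∃ Ls : CCMFBm.L2 T ≃L[ℝ] CCMFBm.L2 T,
      (∀ t ∈ Set.Icc 0 T, Ls (CCMFBm.indL2 T t) =ᵐ[CCMFBm.leb T] CCMFBm.Lker a b H t) ∧
      (∀ t ∈ Set.Icc 0 T, Ls.symm (CCMFBm.indL2 T t) =ᵐ[CCMFBm.leb T] CCMFBm.Linv a b H t) ∧
      ∀ (f : ℝ → ℝ) (hf : MeasureTheory.MemLp f 2 (CCMFBm.leb T)),
        -- the integrals in the two formulas converge absolutely for almost every `t`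
        (∀ᵐ t ∂CCMFBm.leb T,
          IntervalIntegrable (fun s => f s * deriv (fun u => CCMFBm.KH H u t) s)
            MeasureTheory.volume t T) ∧
        (∀ᵐ t ∂CCMFBm.leb T,
          (CCMFBm.stieltjes (fun s => CCMFBm.Linv a b H s t) t T).IntegrableOn
            (fun s => f s - f t) (Set.Icc t T)) ∧
        -- the formulas give `L^*` and its inverse
        Ls (hf.toLp f) =ᵐ[CCMFBm.leb T] CCMFBm.Lstar a b H T f ∧
        Ls.symm (hf.toLp f) =ᵐ[CCMFBm.leb T] CCMFBm.LstarInv a b H T f ∧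
        -- the transfer principle
        CCMFBm.wienerIntegral X f = CCMFBm.wienerIntegral W (CCMFBm.Lstar a b H T f) ∧
        CCMFBm.wienerIntegral W f = CCMFBm.wienerIntegral X (CCMFBm.LstarInv a b H T f) := by

  obtain ⟨ha, hb⟩ := mul_ne_zero_iff.1 hab
  obtain ⟨Ls, hLi, hLsi, hL⟩ := CCMFBm.exists_LstarEquiv hT ha hb hH
  have hcov := CCMFBm.covFun_brownian hW
  have hΛW : CCMFBm.IntegrandSpaceEqL2 W :=
    CCMFBm.integrandSpaceEqL2_of_covFun hT.le W (ContinuousLinearEquiv.refl ℝ _) hcov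
  have hXL : ∀ t, X.toL2 t = CCMFBm.wienerCLM W hΛW (Ls (CCMFBm.indL2 T t)) := fun t =>
    CCMFBm.toL2_eq_wienerCLM hb hX hΛW (hLi t t.2)
  -- The Wiener integral of W preserves inner products, so E[X_t X_s] is the inner product of the
  -- images of 1_t and 1_s under `Ls`.
  have hΛX : CCMFBm.IntegrandSpaceEqL2 X :=
    CCMFBm.integrandSpaceEqL2_of_covFun hT.le X Ls fun t s => by
      rw [← CCMFBm.inner_toL2, hXL, hXL, CCMFBm.wienerCLM_inner hT.le hΛW hcov]
  have htransfer : CCMFBm.wienerCLM X hΛX =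
      (CCMFBm.wienerCLM W hΛW).comp (Ls : CCMFBm.L2 T →L[ℝ] CCMFBm.L2 T) :=
    CCMFBm.clm_ext_indL2 hT.le fun t => by
      rw [CCMFBm.wienerCLM_indL2, hXL]
      rfl
  refine ⟨hΛW, hΛX, fun t ht s hs => CCMFBm.summable_LinvTerm hH.1 hs.1 ht.2 hT,
    fun s hs => CCMFBm.boundedVariationOn_Linv hH.1 hs.1 hT, Ls, hLi, hLsi, fun f hf => ?_⟩
  obtain ⟨h1, h2, h3, h4⟩ := hL f hf
  refine ⟨h1, h2, h3, h4, ?_, ?_⟩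
  · obtain ⟨hg, e⟩ := CCMFBm.memLp_and_toLp_of_ae_eq h3
    rw [CCMFBm.wienerIntegral_eq X hΛX hf, CCMFBm.wienerIntegral_eq W hΛW hg, e, htransfer]
    rfl
  · obtain ⟨hg, e⟩ := CCMFBm.memLp_and_toLp_of_ae_eq h4
    rw [CCMFBm.wienerIntegral_eq W hΛW hf, CCMFBm.wienerIntegral_eq X hΛX hg, e, htransfer]
    -- The second transfer identity is the first one applied to `Ls.symm` of f.
    change _ = CCMFBm.wienerCLM W hΛW (Ls (Ls.symm (hf.toLp f)))
    rw [Ls.apply_symm_apply]
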